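/- Let $\mathcal H$ be a separable infinite-dimensional real Hilbert space with complete orthonormal system $(e_p)_{p\ge1}$. Let $A$ be the self-adjoint operator with $Ae_p=-\lambda_pe_p$, where $0<\lambda_1\le\lambda_2\le\dots$ and $\lambda_p\to\infty$. Let $Q$ be a bounded operator on $\mathcal H$ with $Qe_p=q_pe_p$, $q_p\ge0$, and assume $$\overline s=\sup\{s\in(0,1):\ \mathrm{Trace}((-A)^{-1+s}Q)<\infty\}>0 .$$ Let $B$ be a bounded operator with $Be_p=-b_pe_p$, $b_p\in(-\lambda_1,\lambda_1)$ for all $p$, and let $L=\|B\|$ ($1/L=+\infty$ if $B=0$). Let $\sigma\in\mathbb R$, let $W^Q(t)=\sum_p\sqrt{q_p}\,\beta_p(t)e_p$ be a $Q$-Wiener process, where $(\beta_p)$ are independent standard scalar Wiener processes, and consider the mild solutions, with continuous paths in $\mathcal H$, of $$du(t)=(A+B)u(t)\,dt+\sigma\,dW^Q(t),\qquad u(0)=u_0 .$$ This equation has a unique invariant probability distribution $\mu_\infty$ on $\mathcal H$. For $h>0$ put $\xi_n^Q=h^{-1/2}\bigl(W^Q((n+1)h)-W^Q(nh)\bigr)$,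 $J_1=(I-hA)^{-1}$, $J_2=(I-\frac{3-\sqrt2}{2}hA)^{-1}$, and let $J_3$ be any bounded operator with $J_3QJ_3^T=(I-\frac h2A)^{-1}Q$. Consider the scheme $$u_{n+1}=J_1\Bigl(u_n+hB\bigl(u_n+\tfrac12\sigma\sqrt h\,J_2\xi_n^Q\bigr)+\tfrac{\sqrt2-1}{2}\sigma\sqrt h\,J_2\xi_n^Q\Bigr)+\tfrac{3-\sqrt2}{2}\sigma\sqrt h\,J_2\xi_n^Q,\qquad \overline u_n=u_n+\tfrac12\sigma\sqrt h\,J_3\xi_n^Q .$$ For every $h\in(0,1/L)$ the Markov chain $(u_n,\overline u_{n-1})$ on $\mathcal H\times\mathcal H$ has a unique invariant probability distribution; let $\overline\mu_\infty^h$ be its second marginal. Then for every $s<\overline s$ there is a constant $C_s\in(0,\infty)$, depending only on $s$, $A$, $Q$ and $B$, such that for every $h\in(0,1/L)$ and every $\varphi\in C^2(\mathcal H,\mathbb R)$ with $\sup_{v\in\mathcal H}\|D^2\varphi(v)\|<\infty$, the function $\varphi$ is integrable with respect to $\mu_\infty$ and $\overline\mu_\infty^h$ and $$\Bigl|\int_{\mathcal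 H}\varphi\,d\mu_\infty-\int_{\mathcal H}\varphi\,d\overline\mu_\infty^h\Bigr|\le C_s\,\sup_{v\in\mathcal H}\|D^2\varphi(v)\|\,\sigma^2\,h^{1+s}.$$ Moreover, if $B=0$, then the method is exact: $\overline\mu_\infty^h=\mu_\infty$ for every $h>0$. -/

import Mathlib

open MeasureTheory ProbabilityTheory Filter Topology
open scoped NNReal ENNReal RealInnerProductSpace

noncomputable section

namespace PostprocSPDE

variable {H : Type*} [NormedAddCommGroup H] [InnerProductSpace ℝ H]
variable {Ω : Type*} [MeasurableSpace Ω]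

/-- Given a complete orthonormal system `e` and the eigenvalues `lam` of `-A`
(so that `A e_p = -lam_p e_p`), the operator `f(-A) u = ∑_p f(lam_p) ⟨u, e_p⟩ e_p`.
It is only used for functions `f` that are bounded on the spectrum of `-A`, for which the
series converges for every `u` in `H`. -/
def spectralOp (e : HilbertBasis ℕ ℝ H) (lam : ℕ → ℝ) (f : ℝ → ℝ) (u : H) : H :=
  ∑' p, (f (lam p) * ⟪e p, u⟫) • e p

/-- The semigroup `e^{tA}`, for `t ≥ 0`. -/
def semigroup (e : HilbertBasis ℕ ℝ H) (lam : ℕ → ℝ) (t : ℝ) : H → H :=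
  spectralOp e lam (fun x => Real.exp (-t * x))

/-- The resolvent operator `(I - c A)⁻¹`, for `c > 0`. -/
def resolvent (e : HilbertBasis ℕ ℝ H) (lam : ℕ → ℝ) (c : ℝ) : H → H :=
  spectralOp e lam (fun x => (1 + c * x)⁻¹)

/-- The regularity index `sup {s ∈ (0,1) : Trace ((-A)^{-1+s} Q) < ∞}`, where `Q e_p = q_p e_p`
with `q_p ≥ 0`. The supremum of the empty set is `0` here, so that this number is positive if and
only if the trace is finite for some `s ∈ (0,1)`. -/
def sBar (lam q : ℕ → ℝ) : ℝ :=
  sSup {s : ℝ | 0 < s ∧ s < 1 ∧ Summable (fun p => lam p ^ (-1 + s) * q p)}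

/-- `Y` is the sum of the series `∑_p X_p` of `E`-valued random variables, in `L²(Ω; E)`. -/
def IsL2Sum {E : Type*} [NormedAddCommGroup E] (P : Measure Ω) (X : ℕ → Ω → E) (Y : Ω → E) :
    Prop :=
  MemLp Y 2 P ∧
    Tendsto (fun N : ℕ => eLpNorm (fun ω => Y ω - ∑ p ∈ Finset.range N, X p ω) 2 P) atTop (𝓝 0)

/-- `β_0, β_1, …` are independent standard scalar Wiener processes. The `Q`-Wiener process is
then `W^Q(t) = ∑_p √q_p β_p(t) e_p`; if `Q` is not of trace class this series does not converge
in `H`, and `W^Q` enters below only through images under suitable operators. -/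
def IsWienerFamily (P : Measure Ω) (β : ℕ → ℝ≥0 → Ω → ℝ) : Prop :=
  (∀ p t, Measurable (β p t)) ∧ (∀ p, IsBrownianReal (β p) P) ∧
    iIndepFun (fun p ω t => β p t ω) P

/-- `I` is the Wiener integral `∫_0^t f(r) dw(r)` of the continuous deterministic function `f`
against the scalar Wiener process `w`: the limit in `L²(Ω)` of the Riemann–Itô sums. -/
def IsWienerIntegral (P : Measure Ω) (w : ℝ≥0 → Ω → ℝ) (f : ℝ → ℝ) (t : ℝ≥0) (I : Ω → ℝ) :
    Prop :=
  MemLp I 2 P ∧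
    Tendsto (fun n : ℕ => eLpNorm (fun ω => I ω - ∑ k ∈ Finset.range n,
        f ((k : ℝ) * t / n) *
          (w (((k : ℝ≥0) + 1) * t / n) ω - w ((k : ℝ≥0) * t / n) ω)) 2 P) atTop (𝓝 0)

/-- `Z` is the stochastic convolution
`∫_0^t e^{(t-r)A} dW^Q(r) = ∑_p √q_p (∫_0^t e^{-(t-r) lam_p} dβ_p(r)) e_p`. -/
def IsStochConv (P : Measure Ω) (e : HilbertBasis ℕ ℝ H) (lam q : ℕ → ℝ)
    (β : ℕ → ℝ≥0 → Ω → ℝ) (t : ℝ≥0) (Z : Ω → H) : Prop :=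
  ∃ I : ℕ → Ω → ℝ,
    (∀ p, IsWienerIntegral P (β p) (fun r => Real.exp (-((t : ℝ) - r) * lam p)) t (I p)) ∧
    IsL2Sum P (fun p ω => (√(q p) * I p ω) • e p) Z

/-- `u` is a mild solution of `du = (A u + F(u)) dt + σ dW^Q`, `u(0) = x`: an `H`-valued
continuous process with
`u(t) = e^{tA} x + ∫_0^t e^{(t-r)A} F(u(r)) dr + σ ∫_0^t e^{(t-r)A} dW^Q(r)` almost surely,
for every `t ≥ 0`. -/
def IsMildSolution [MeasurableSpace H] (P : Measure Ω) (e : HilbertBasis ℕ ℝ H)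
    (lam q : ℕ → ℝ) (β : ℕ → ℝ≥0 → Ω → ℝ) (F : H → H) (σ : ℝ) (x : H) (u : ℝ≥0 → Ω → H) :
    Prop :=
  (∀ t, Measurable (u t)) ∧ (∀ᵐ ω ∂P, Continuous (fun t => u t ω)) ∧
    ∀ t : ℝ≥0, ∃ Z : Ω → H, IsStochConv P e lam q β t Z ∧
      ∀ᵐ ω ∂P, u t ω = semigroup e lam t x
        + (∫ r in (0 : ℝ)..(t : ℝ), semigroup e lam ((t : ℝ) - r) (F (u r.toNNReal ω)))
        + σ • Z ω

/-- `μ` is an invariant probability distribution of the Markov process whose trajectory from `x`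
is `u x`, i.e. of the transition kernels `κ_t(x, ·) = law of u x t`. -/
def IsInvariantLaw [MeasurableSpace H] (P : Measure Ω) (u : H → ℝ≥0 → Ω → H) (μ : Measure H) :
    Prop :=
  IsProbabilityMeasure μ ∧ ∃ κ : ℝ≥0 → Kernel H H,
    (∀ t x, κ t x = P.map (u x t)) ∧ ∀ t, (κ t).Invariant μ

/-- The scalar normalized increments `ξ_{n,p} = h^{-1/2} (β_p((n+1)h) - β_p(nh))`. -/
def increment (β : ℕ → ℝ≥0 → Ω → ℝ) (h : ℝ) (n p : ℕ) (ω : Ω) : ℝ :=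
  (β p (((n : ℝ) + 1) * h).toNNReal ω - β p ((n : ℝ) * h).toNNReal ω) / √h

/-- `X` is the `H`-valued Gaussian random variable `J ξ_n^Q = ∑_p √q_p ξ_{n,p} J e_p`, where
`ξ_n^Q = h^{-1/2} (W^Q((n+1)h) - W^Q(nh))` and `J` is a linear operator. -/
def IsNoise (P : Measure Ω) (e : HilbertBasis ℕ ℝ H) (q : ℕ → ℝ) (β : ℕ → ℝ≥0 → Ω → ℝ)
    (h : ℝ) (n : ℕ) (J : H → H) (X : Ω → H) : Prop :=
  IsL2Sum P (fun p ω => (√(q p) * increment β h n p ω) • J (e p)) X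

/-- The coefficient `(3 - √2) / 2`. -/
def theta : ℝ := (3 - √2) / 2

/-- One step of the integrator from `x`, with `J₁ = (I - hA)⁻¹` and with `η` the value of
`J₂ ξ_n^Q`, `J₂ = (I - (3 - √2)/2 hA)⁻¹`. -/
def schemeStep (e : HilbertBasis ℕ ℝ H) (lam : ℕ → ℝ) (F : H → H) (σ h : ℝ) (x η : H) : H :=
  resolvent e lam h
      (x + h • F (x + (1 / 2 * σ * √h) • η) + ((√2 - 1) / 2 * σ * √h) • η)
    + (theta * σ * √h) • η

/-- The postprocessor applied to `x`, with `ζ` the value of `J₃ ξ_n^Q`. -/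
def postprocess (σ h : ℝ) (x ζ : H) : H := x + (1 / 2 * σ * √h) • ζ

/-- The requirement `J₃ Q J₃ᵀ = (I - h/2 A)⁻¹ Q` on the operator `J₃`. -/
def IsPostprocOp [CompleteSpace H] (e : HilbertBasis ℕ ℝ H) (lam : ℕ → ℝ) (Q : H →L[ℝ] H)
    (h : ℝ) (J₃ : H →L[ℝ] H) : Prop :=
  ∀ v, J₃ (Q (ContinuousLinearMap.adjoint J₃ v)) = resolvent e lam (h / 2) (Q v)

/-- `K` is the transition kernel of the Markov chain `(u_n, ubar_{n-1})` on `H × H`: from a state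
`z` with `u_n = z.1`, the next state is `(u_{n+1}, ubar_n)`, computed from `z.1` and `ξ_n^Q`. -/
def IsChainKernel [MeasurableSpace H] (P : Measure Ω) (e : HilbertBasis ℕ ℝ H)
    (lam q : ℕ → ℝ) (β : ℕ → ℝ≥0 → Ω → ℝ) (F : H → H) (σ h : ℝ) (J₃ : H →L[ℝ] H)
    (K : Kernel (H × H) (H × H)) : Prop :=
  ∀ n : ℕ, ∃ X₂ X₃ : Ω → H,
    IsNoise P e q β h n (resolvent e lam (theta * h)) X₂ ∧ IsNoise P e q β h n J₃ X₃ ∧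
    ∀ z : H × H, K z =
      P.map (fun ω => (schemeStep e lam F σ h z.1 (X₂ ω), postprocess σ h z.1 (X₃ ω)))

/-- `M` is an invariant probability distribution of the Markov chain `(u_n, ubar_{n-1})`. Its
second marginal is the invariant law of the postprocessed sequence. -/
def IsChainInvariantLaw [MeasurableSpace H] (P : Measure Ω) (e : HilbertBasis ℕ ℝ H)
    (lam q : ℕ → ℝ) (β : ℕ → ℝ≥0 → Ω → ℝ) (F : H → H) (σ h : ℝ) (J₃ : H →L[ℝ] H)
    (M : Measure (H × H)) : Prop :=
  IsProbabilityMeasure M ∧ ∃ K : Kernel (H × H) (H × H),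
    IsChainKernel P e lam q β F σ h J₃ K ∧ K.Invariant M

end PostprocSPDE

end

/-! Everything is diagonal in the basis `e`. The invariant laws of the equation and of the
integrator, and the law after postprocessing, are centered Gaussian laws with diagonal covariance
(`HasDiagCov`), so the theorem reduces to a comparison of sequences of variances. A mode of the
equation is an Ornstein–Uhlenbeck process of rate λ + b, with stationary variance v = σ²q/(2(λ +
b)). A mode of the integrator is a scalar autoregression with factor a = (1 - hb)/(1 + hλ), and the
postprocessor adds an independent Gaussian term of variance σ²hq/(4(1 + hλ/2)).

Variances: with x = hλ and y = hb, the relative defect between v and the postprocessed variance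
vanishes for y = 0, which is the exactness, and also for x = 0. It is at most 8|y|x/(1 + x)
(`abs_variance_defect_le`). Since v is bounded by a multiple of σ²q/λ and x/(1 + x) ≤ x^s, summation
over the modes gives h^(1+s) times the trace of (-A)^(-1+s)Q (`exists_variance_bound`).

Weak error: two such Gaussian laws share a Gaussian part, with the smaller variance in each mode,
and differ by independent symmetric increments. The first-order Taylor term of an increment has mean
zero, so only sup ‖D²φ‖ times the sum of |v - w| remains (`abs_integral_sub_integral_le`).

Invariant laws: they are identified through characteristic functions. For a transition x ↦ Sx +
noise with S diagonal and |a| < 1, invariance iterated n times transports the characteristic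
function from ξ to S^n ξ → 0, which leaves only the Gaussian with variance v satisfying v = a²v + w
(`IsDiagAutoRegression.hasDiagCov_of_invariant`). For the equation, this form of the transition
comes from projecting the mild formulation on each mode and solving it path by path
(`IsMildSolution.inner_ae_eq`). -/

namespace PostprocSPDE

/-! ### Gaussian series in a Hilbert space -/

/-- The law of a sequence of independent standard Gaussian variables. -/
noncomputable def gaussSeq : Measure (ℕ → ℝ) := Measure.infinitePi fun _ => gaussianReal 0 1

instance : IsProbabilityMeasure gaussSeq := by unfold gaussSeq; infer_instance

lemma hasLaw_eval_gaussSeq (p : ℕ) :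
    HasLaw (fun x : ℕ → ℝ => x p) (gaussianReal 0 1) gaussSeq :=
  (measurePreserving_eval_infinitePi (fun _ : ℕ => gaussianReal 0 1) p).hasLaw

lemma iIndepFun_gaussSeq : iIndepFun (fun p (x : ℕ → ℝ) => x p) gaussSeq :=
  iIndepFun_infinitePi (P := fun _ : ℕ => gaussianReal 0 1) (X := fun _ x => x)
    (fun _ => measurable_id)

lemma integral_eval_mul_eval_gaussSeq (p q : ℕ) :
    ∫ x, x p * x q ∂gaussSeq = if p = q then 1 else 0 := by
  have hm : ∀ p, ∫ x, x p ∂gaussSeq = 0 := fun p => by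
    rw [(hasLaw_eval_gaussSeq p).integral_eq, integral_id_gaussianReal]
  split_ifs with h
  · subst h
    have h1 := (hasLaw_eval_gaussSeq p).variance_eq
    rw [variance_id_gaussianReal, variance_eq_integral (measurable_pi_apply p).aemeasurable, hm] at h1
    simpa [sq] using h1
  · have := (iIndepFun_gaussSeq.indepFun h).integral_fun_mul_eq_mul_integral
      (measurable_pi_apply p).aestronglyMeasurable (measurable_pi_apply q).aestronglyMeasurable
    rw [this, hm, zero_mul]

lemma memLp_eval_gaussSeq (p : ℕ) : MemLp (fun x : ℕ → ℝ => x p) 2 gaussSeq :=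
  (hasLaw_eval_gaussSeq p).hasGaussianLaw.memLp_two

lemma memLp_eval_smul {E : Type*} [NormedAddCommGroup E] [InnerProductSpace ℝ E]
    [MeasurableSpace E] [BorelSpace E] [SecondCountableTopology E] (a : E) (p : ℕ) :
    MemLp (fun x : ℕ → ℝ => x p • a) 2 gaussSeq := by
  refine MemLp.of_le_mul (c := ‖a‖) (memLp_eval_gaussSeq p)
    ((measurable_pi_apply p).smul_const a).aestronglyMeasurable (.of_forall fun x => ?_)
  rw [norm_smul, mul_comm]

section L2Sum

variable {E : Type*} [NormedAddCommGroup E] [InnerProductSpace ℝ E] [CompleteSpace E]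
  [MeasurableSpace E] [BorelSpace E] [SecondCountableTopology E]

/-- The terms are pairwise orthogonal in `L²`, so square summability of the norms is enough. Working
on the sequence space yields one measurable map `G`, which can be evaluated at the increments of any
time step. -/
lemma exists_isL2Sum_gaussSeq (a : ℕ → E) (ha : Summable fun p => ‖a p‖ ^ 2) :
    ∃ G : (ℕ → ℝ) → E, Measurable G ∧ IsL2Sum gaussSeq (fun p x => x p • a p) G := by
  let f : ℕ → Lp E 2 gaussSeq := fun p => (memLp_eval_smul (a p) p).toLp _
  have hin : ∀ p q, ⟪f p, f q⟫ = if p = q then ‖a p‖ ^ 2 else 0 := by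
    intro p q
    rw [L2.inner_def]
    have : ∫ x, ⟪f p x, f q x⟫ ∂gaussSeq = ∫ x, (x p * x q) * ⟪a p, a q⟫ ∂gaussSeq := by
      refine integral_congr_ae ?_
      filter_upwards [(memLp_eval_smul (a p) p).coeFn_toLp, (memLp_eval_smul (a q) q).coeFn_toLp]
        with x h1 h2
      rw [h1, h2, real_inner_smul_left, real_inner_smul_right]
      ring
    rw [this, integral_mul_const, integral_eval_mul_eval_gaussSeq]
    split_ifs with h
    · subst h; simp
    · simp
  have horth : OrthogonalFamily ℝ (fun p => (Submodule.span ℝ {f p} : Submodule ℝ (Lp E 2 gaussSeq)))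
      (fun p => (Submodule.span ℝ {f p}).subtypeₗᵢ) := by
    refine OrthogonalFamily.of_pairwise fun p q hpq => ?_
    refine Submodule.isOrtho_span.2 ?_
    rintro u rfl v rfl
    rw [hin, if_neg hpq]
  have hsum : Summable f := by
    have := (horth.summable_iff_norm_sq_summable
      (fun p => ⟨f p, Submodule.mem_span_singleton_self _⟩)).2 ?_
    · simpa using this
    · convert ha using 2 with p
      have := hin p p
      rw [real_inner_self_eq_norm_sq, if_pos rfl] at this
      simpa using this
  have hF := hsum.hasSum.tendsto_sum_nat
  set F := ∑' p, f p with hFdef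
  refine ⟨F, (Lp.stronglyMeasurable F).measurable, Lp.memLp F, ?_⟩
  have h1 : Tendsto (fun N => ENNReal.ofReal ‖F - ∑ p ∈ Finset.range N, f p‖) atTop (𝓝 0) := by
    rw [← ENNReal.ofReal_zero]
    refine (ENNReal.continuous_ofReal.tendsto _).comp ?_
    simpa using ((tendsto_const_nhds (x := F)).sub hF).norm
  refine h1.congr fun N => ?_
  rw [ofReal_norm, Lp.enorm_def]
  refine eLpNorm_congr_ae ?_
  have h2 : ∀ᵐ x ∂gaussSeq, ∀ p, f p x = x p • a p :=
    ae_all_iff.2 fun p => (memLp_eval_smul (a p) p).coeFn_toLp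
  have h3 : (↑↑(∑ p ∈ Finset.range N, f p) : (ℕ → ℝ) → E) =ᵐ[gaussSeq]
      fun x => ∑ p ∈ Finset.range N, f p x := by
    filter_upwards [Lp.coeFn_finsetSum (Finset.range N) f] with x hx
    rw [hx, Finset.sum_apply]
  filter_upwards [Lp.coeFn_sub F (∑ p ∈ Finset.range N, f p), h2, h3] with x hx hx2 hx3
  rw [hx, Pi.sub_apply, hx3]
  simp [hx2]

end L2Sum

/-! ### Limits of `L²` series and their Fourier transforms -/

section L2SumLemmas

variable {E : Type*} [NormedAddCommGroup E] {Ω : Type*} [MeasurableSpace Ω] {P : Measure Ω}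

lemma IsL2Sum.ae_eq {X : ℕ → Ω → E} {Y Y' : Ω → E}
    (hX : ∀ p, AEStronglyMeasurable (X p) P) (h : IsL2Sum P X Y) (h' : IsL2Sum P X Y') :
    Y =ᵐ[P] Y' := by
  have hS : ∀ N, AEStronglyMeasurable (fun ω => ∑ p ∈ Finset.range N, X p ω) P := fun N => by
    fun_prop
  have h0 : eLpNorm (Y - Y') 2 P = 0 := by
    have hlim := h.2.add h'.2
    rw [add_zero] at hlim
    refine le_antisymm (ge_of_tendsto' hlim fun N => ?_) zero_le
    have h1 : Y - Y' = (fun ω => Y ω - ∑ p ∈ Finset.range N, X p ω) -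
        fun ω => Y' ω - ∑ p ∈ Finset.range N, X p ω := by
      ext ω; simp
    rw [h1]
    exact eLpNorm_sub_le (h.1.1.sub (hS N)) (h'.1.1.sub (hS N)) (by norm_num)
  rw [eLpNorm_eq_zero_iff (h.1.1.sub h'.1.1) (by norm_num)] at h0
  filter_upwards [h0] with ω hω
  exact sub_eq_zero.1 hω

lemma IsL2Sum.comp {Ω' : Type*} [MeasurableSpace Ω'] {P' : Measure Ω'} {X : ℕ → Ω' → E} {Y : Ω' → E}
    (hX : ∀ p, AEStronglyMeasurable (X p) P') (h : IsL2Sum P' X Y) {g : Ω → Ω'}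
    (hg : MeasurePreserving g P P') :
    IsL2Sum P (fun p ω => X p (g ω)) (fun ω => Y (g ω)) := by
  refine ⟨h.1.comp_measurePreserving hg, h.2.congr fun N => ?_⟩
  have hS : AEStronglyMeasurable (fun ω => Y ω - ∑ p ∈ Finset.range N, X p ω) P' :=
    h.1.1.sub (by fun_prop)
  exact (eLpNorm_comp_measurePreserving hS hg).symm

/-- Along a subsequence, the partial sums of an `L²` series converge almost surely. -/
lemma IsL2Sum.exists_seq_tendsto_ae {X : ℕ → Ω → E} {Y : Ω → E}
    (hX : ∀ p, AEStronglyMeasurable (X p) P) (h : IsL2Sum P X Y) :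
    ∃ ns : ℕ → ℕ, StrictMono ns ∧ ∀ᵐ ω ∂P,
      Tendsto (fun k => ∑ p ∈ Finset.range (ns k), X p ω) atTop (𝓝 (Y ω)) := by
  refine (tendstoInMeasure_of_tendsto_eLpNorm (p := 2) (f := fun N ω => ∑ p ∈ Finset.range N, X p ω)
    (by norm_num) (fun N => by fun_prop) h.1.1 ?_).exists_seq_tendsto_ae
  refine h.2.congr fun N => ?_
  rw [← eLpNorm_neg]
  congr 1
  ext ω
  simp

end L2SumLemmas

/-- Almost sure convergence implies convergence of `E exp(i X)`. -/
lemma tendsto_integral_cexp_of_ae {Ω : Type*} [MeasurableSpace Ω] {P : Measure Ω}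
    [IsFiniteMeasure P] {X : ℕ → Ω → ℝ} {Y : Ω → ℝ} (hX : ∀ n, AEMeasurable (X n) P)
    (h : ∀ᵐ ω ∂P, Tendsto (fun n => X n ω) atTop (𝓝 (Y ω))) :
    Tendsto (fun n => ∫ ω, Complex.exp (X n ω * Complex.I) ∂P) atTop
      (𝓝 (∫ ω, Complex.exp (Y ω * Complex.I) ∂P)) := by
  refine tendsto_integral_of_dominated_convergence (fun _ => 1) (fun n => ?_)
    (integrable_const _) (fun n => .of_forall fun ω => ?_) ?_
  · exact (Complex.measurable_exp.comp_aemeasurable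
      ((Complex.measurable_ofReal.comp_aemeasurable (hX n)).mul_const _)).aestronglyMeasurable
  · rw [Complex.norm_exp_ofReal_mul_I]
  · filter_upwards [h] with ω hω
    exact ((Complex.continuous_exp.comp (Complex.continuous_ofReal.mul continuous_const)).tendsto
      _).comp hω

/-- `E exp(i ∑ c_p X_p)` for independent variables `X_p` with Gaussian-type Fourier transform. -/
lemma integral_cexp_sum_of_iIndepFun {Ω : Type*} [MeasurableSpace Ω] {P : Measure Ω}
    [IsProbabilityMeasure P] {X : ℕ → Ω → ℝ} (hX : ∀ p, AEMeasurable (X p) P)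
    (hind : iIndepFun X P) (N : ℕ) (c : ℕ → ℝ) :
    ∫ ω, Complex.exp ((∑ p ∈ Finset.range N, c p * X p ω : ℝ) * Complex.I) ∂P =
      ∏ p ∈ Finset.range N, charFun (P.map (X p)) (c p) := by
  have h1 : iIndepFun (fun p ω => c p * X p ω) P :=
    hind.comp (fun p x => c p * x) (fun p => by fun_prop)
  have h2 := (h1.restrict (Finset.range N)).charFun_map_fun_finsetSum_eq_prod
    (s := Finset.range N) (fun i _ => (hX i).const_mul _)
  have h3 := congrFun h2 1
  rw [charFun_apply_real, integral_map (Finset.aemeasurable_fun_sum _ fun i _ => (hX i).const_mul _)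
    (by fun_prop)] at h3
  simp only [Complex.ofReal_one, one_mul] at h3
  rw [h3, Finset.prod_apply]
  refine Finset.prod_congr rfl fun p _ => ?_
  rw [charFun_map_mul_comp (hX p), mul_one]

/-! ### Centered Gaussian laws with diagonal covariance -/

section DiagCov

variable {H : Type*} [NormedAddCommGroup H] [InnerProductSpace ℝ H]

lemma hasSum_inner_sq (e : HilbertBasis ℕ ℝ H) (x : H) :
    HasSum (fun p => ⟪e p, x⟫ ^ 2) (‖x‖ ^ 2) := by
  have := e.hasSum_inner_mul_inner x x
  rw [real_inner_self_eq_norm_sq] at this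
  refine this.congr_fun fun p => ?_
  rw [real_inner_comm, sq]

lemma summable_mul_inner_sq (e : HilbertBasis ℕ ℝ H) {v : ℕ → ℝ} {C : ℝ} (hC : ∀ p, |v p| ≤ C)
    (x : H) : Summable fun p => v p * ⟪e p, x⟫ ^ 2 := by
  refine Summable.of_norm_bounded ((hasSum_inner_sq e x).summable.mul_left C) fun p => ?_
  rw [norm_mul, Real.norm_eq_abs, Real.norm_of_nonneg (sq_nonneg _)]
  exact mul_le_mul_of_nonneg_right (hC p) (sq_nonneg _)

lemma exists_abs_le_of_summable {v : ℕ → ℝ} (hv : Summable v) : ∃ C, ∀ p, |v p| ≤ C := by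
  obtain ⟨C, hC⟩ := hv.tendsto_atTop_zero.abs.bddAbove_range
  exact ⟨C, fun p => hC ⟨p, rfl⟩⟩

lemma summable_mul_inner_sq_of_summable {v : ℕ → ℝ} (hv : Summable v) (e : HilbertBasis ℕ ℝ H) (x : H) :
    Summable fun p => v p * ⟪e p, x⟫ ^ 2 :=
  let ⟨_, hC⟩ := exists_abs_le_of_summable hv
  summable_mul_inner_sq e hC x

variable [MeasurableSpace H]

/-- `μ` is the centered Gaussian law whose covariance operator is diagonal in the basis `e`, with
eigenvalues `v`. -/
def HasDiagCov (e : HilbertBasis ℕ ℝ H) (v : ℕ → ℝ) (μ : Measure H) : Prop :=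
  IsProbabilityMeasure μ ∧
    ∀ ξ, charFun μ ξ = (Real.exp (-(∑' p, v p * ⟪e p, ξ⟫ ^ 2) / 2) : ℝ)

variable [BorelSpace H]

/-- Partial sums have product Fourier transforms, and the limit is taken along an almost surely
convergent subsequence. The vectors `a p` need not be orthogonal, which is what admits a
non-diagonal `J₃`. -/
lemma charFun_map_of_isL2Sum [SecondCountableTopology H] {a : ℕ → H} (ha : Summable fun p => ‖a p‖ ^ 2)
    {G : (ℕ → ℝ) → H} (hGm : Measurable G) (hG : IsL2Sum gaussSeq (fun p x => x p • a p) G) (ξ : H) :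
    charFun (gaussSeq.map G) ξ = (Real.exp (-(∑' p, ⟪a p, ξ⟫ ^ 2) / 2) : ℝ) := by
  have hm : ∀ p, AEStronglyMeasurable (fun x : ℕ → ℝ => x p • a p) gaussSeq := fun p =>
    ((measurable_pi_apply p).smul_const (a p)).aestronglyMeasurable
  obtain ⟨ns, hns, hlim⟩ := hG.exists_seq_tendsto_ae hm
  have hs : Summable fun p => ⟪a p, ξ⟫ ^ 2 := by
    refine Summable.of_nonneg_of_le (fun p => sq_nonneg _) (fun p => ?_) (ha.mul_right (‖ξ‖ ^ 2))
    rw [← mul_pow, ← sq_abs]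
    exact pow_le_pow_left₀ (abs_nonneg _) (abs_real_inner_le_norm _ _) 2
  have h1 := tendsto_integral_cexp_of_ae (P := gaussSeq)
    (X := fun k x => ∑ p ∈ Finset.range (ns k), ⟪a p, ξ⟫ * x p) (Y := fun x => ⟪G x, ξ⟫)
    (fun k => (Finset.measurable_fun_sum _ fun p _ =>
      (measurable_pi_apply p).const_mul _).aemeasurable) (by
      filter_upwards [hlim] with x hx
      have := (hx.inner (tendsto_const_nhds (x := ξ)) (𝕜 := ℝ))
      refine this.congr fun k => ?_
      rw [sum_inner]
      refine Finset.sum_congr rfl fun p _ => ?_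
      rw [real_inner_smul_left, mul_comm])
  rw [charFun_apply, integral_map hGm.aemeasurable
    (by fun_prop)]
  refine tendsto_nhds_unique h1 ?_
  have h2 : ∀ k, ∫ x, Complex.exp ((∑ p ∈ Finset.range (ns k), ⟪a p, ξ⟫ * x p : ℝ) * Complex.I)
      ∂gaussSeq = (Real.exp (-(∑ p ∈ Finset.range (ns k), ⟪a p, ξ⟫ ^ 2) / 2) : ℝ) := fun k => by
    rw [integral_cexp_sum_of_iIndepFun (fun p => (measurable_pi_apply p).aemeasurable)
      iIndepFun_gaussSeq]
    simp_rw [fun p => (hasLaw_eval_gaussSeq p).map_eq, charFun_gaussianReal]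
    rw [← Complex.exp_sum]
    push_cast
    congr 1
    rw [neg_div, Finset.sum_div, ← Finset.sum_neg_distrib]
    refine Finset.sum_congr rfl fun p _ => ?_
    simp
  simp_rw [h2]
  refine (Complex.continuous_ofReal.tendsto _).comp ((Real.continuous_exp.tendsto _).comp ?_)
  exact ((hs.hasSum.tendsto_sum_nat.comp hns.tendsto_atTop).neg).div_const 2

variable {e : HilbertBasis ℕ ℝ H}

lemma HasDiagCov.unique [CompleteSpace H] [SecondCountableTopology H] {v : ℕ → ℝ} {μ ν : Measure H}
    (hμ : HasDiagCov e v μ) (hν : HasDiagCov e v ν) : μ = ν := by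
  have := hμ.1
  have := hν.1
  exact Measure.ext_of_charFun (funext fun ξ => by rw [hμ.2, hν.2])

lemma exists_hasDiagCov [CompleteSpace H] [SecondCountableTopology H] (e : HilbertBasis ℕ ℝ H)
    {v : ℕ → ℝ} (hv0 : ∀ p, 0 ≤ v p) (hv : Summable v) : ∃ μ, HasDiagCov e v μ := by
  have hn : ∀ p, ‖√(v p) • e p‖ ^ 2 = v p := fun p => by
    rw [norm_smul, e.orthonormal.norm_eq_one, mul_one, Real.norm_of_nonneg (Real.sqrt_nonneg _),
      Real.sq_sqrt (hv0 p)]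
  have ha : Summable fun p => ‖√(v p) • e p‖ ^ 2 := by simpa only [hn] using hv
  obtain ⟨G, hGm, hG⟩ := exists_isL2Sum_gaussSeq _ ha
  refine ⟨gaussSeq.map G, Measure.isProbabilityMeasure_map hGm.aemeasurable, fun ξ => ?_⟩
  rw [charFun_map_of_isL2Sum ha hGm hG]
  congr! 6 with p
  rw [real_inner_smul_left, mul_pow, Real.sq_sqrt (hv0 p)]

lemma HasDiagCov.conv [SecondCountableTopology H] {v w : ℕ → ℝ} (hv : Summable v)
    (hw : Summable w) {μ ν : Measure H}
    (hμ : HasDiagCov e v μ) (hν : HasDiagCov e w ν) :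
    HasDiagCov e (fun p => v p + w p) (μ ∗ ν) := by
  have := hμ.1
  have := hν.1
  refine ⟨inferInstance, fun ξ => ?_⟩
  rw [charFun_conv, hμ.2, hν.2, ← Complex.ofReal_mul, ← Real.exp_add]
  simp_rw [add_mul]
  rw [(summable_mul_inner_sq_of_summable hv e ξ).tsum_add
    (summable_mul_inner_sq_of_summable hw e ξ)]
  ring_nf

lemma HasDiagCov.map_neg [CompleteSpace H] [SecondCountableTopology H] {v : ℕ → ℝ} {μ : Measure H}
    (hμ : HasDiagCov e v μ) : μ.map (fun x => -x) = μ := by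
  have := hμ.1
  have hp : IsProbabilityMeasure (μ.map fun x => -x) :=
    Measure.isProbabilityMeasure_map measurable_neg.aemeasurable
  refine HasDiagCov.unique (e := e) (v := v) ⟨hp, fun ξ => ?_⟩ hμ
  have h1 := charFun_map_smul (μ := μ) (-1) ξ
  simp only [neg_smul, one_smul] at h1
  rw [h1, hμ.2]
  simp [inner_neg_right]

lemma HasDiagCov.map_inner {v : ℕ → ℝ} (hv0 : ∀ p, 0 ≤ v p) {μ : Measure H}
    (hμ : HasDiagCov e v μ) (p : ℕ) :
    μ.map (fun x => ⟪e p, x⟫) = gaussianReal 0 (v p).toNNReal := by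
  have := hμ.1
  have hm : Measurable fun x : H => ⟪e p, x⟫ := by fun_prop
  have := Measure.isProbabilityMeasure_map (μ := μ) hm.aemeasurable
  refine Measure.ext_of_charFun (funext fun t => ?_)
  have h1 := hμ.2 (t • e p)
  rw [charFun_apply] at h1
  rw [charFun_apply_real, integral_map hm.aemeasurable (by fun_prop), charFun_gaussianReal,
    Real.coe_toNNReal _ (hv0 p)]
  have h2 : ∑' k, v k * ⟪e k, t • e p⟫ ^ 2 = v p * t ^ 2 := by
    rw [tsum_eq_single p]
    · rw [real_inner_smul_right, real_inner_self_eq_norm_sq, e.orthonormal.norm_eq_one]; ring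
    · intro k hk
      rw [real_inner_smul_right, e.orthonormal.inner_eq_zero hk]; ring
  rw [h2] at h1
  have h3 : ∀ x : H, ((t : ℂ) * (⟪e p, x⟫ : ℝ) * Complex.I) = ((⟪x, t • e p⟫ : ℝ) : ℂ) * Complex.I := by
    intro x
    rw [real_inner_smul_right, real_inner_comm]; push_cast; ring
  simp_rw [h3]
  rw [h1]
  push_cast
  congr 1
  ring

/-- Parseval and Tonelli reduce the second moment to the variances of the coordinates. The
`lintegral` form makes integrability a consequence. -/
lemma HasDiagCov.lintegral_norm_sq {v : ℕ → ℝ} (hv0 : ∀ p, 0 ≤ v p) (hv : Summable v)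
    {μ : Measure H} (hμ : HasDiagCov e v μ) :
    ∫⁻ x, ENNReal.ofReal (‖x‖ ^ 2) ∂μ = ENNReal.ofReal (∑' p, v p) := by
  have := hμ.1
  have h1 : ∀ x : H, ENNReal.ofReal (‖x‖ ^ 2) = ∑' p, ENNReal.ofReal (⟪e p, x⟫ ^ 2) := fun x => by
    rw [← (hasSum_inner_sq e x).tsum_eq]
    exact ENNReal.ofReal_tsum_of_nonneg (fun p => sq_nonneg _) (hasSum_inner_sq e x).summable
  simp_rw [h1]
  rw [lintegral_tsum fun p => by fun_prop, ENNReal.ofReal_tsum_of_nonneg hv0 hv]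
  congr 1
  ext p
  have hm : Measurable fun x : H => ⟪e p, x⟫ := by fun_prop
  have h2 : ∫⁻ x, ENNReal.ofReal (⟪e p, x⟫ ^ 2) ∂μ
      = ∫⁻ y, ENNReal.ofReal (y ^ 2) ∂(gaussianReal 0 (v p).toNNReal) := by
    rw [← hμ.map_inner hv0 p, lintegral_map (by fun_prop) hm]
  rw [h2, ← ofReal_integral_eq_lintegral_ofReal]
  · have h3 := variance_id_gaussianReal (μ := 0) (v := (v p).toNNReal)
    rw [variance_eq_integral (by fun_prop)] at h3
    simp only [id, integral_id_gaussianReal, sub_zero] at h3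
    rw [h3, Real.coe_toNNReal _ (hv0 p)]
  · exact (memLp_id_gaussianReal 2).integrable_sq
  · exact .of_forall fun y => sq_nonneg y

lemma HasDiagCov.integrable_norm_sq {v : ℕ → ℝ} (hv0 : ∀ p, 0 ≤ v p) (hv : Summable v)
    {μ : Measure H} (hμ : HasDiagCov e v μ) : Integrable (fun x => ‖x‖ ^ 2) μ := by
  refine ⟨by fun_prop, ?_⟩
  rw [hasFiniteIntegral_iff_ofReal (.of_forall fun x => by positivity), hμ.lintegral_norm_sq hv0 hv]
  exact ENNReal.ofReal_lt_top

lemma HasDiagCov.integral_norm_sq {v : ℕ → ℝ} (hv0 : ∀ p, 0 ≤ v p) (hv : Summable v)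
    {μ : Measure H} (hμ : HasDiagCov e v μ) : ∫ x, ‖x‖ ^ 2 ∂μ = ∑' p, v p := by
  rw [integral_eq_lintegral_of_nonneg_ae (.of_forall fun x => by positivity) (by fun_prop),
    hμ.lintegral_norm_sq hv0 hv, ENNReal.toReal_ofReal (tsum_nonneg hv0)]

end DiagCov

/-! ### Weak error between two Gaussian laws -/

section WeakError

variable {H : Type*} [NormedAddCommGroup H] [NormedSpace ℝ H]

/-- The derivative is `M`-Lipschitz, and the mean value inequality on the segment applies to `φ`
minus its linear part at `x`. The factor 1/2 of Taylor's formula is given up. -/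
lemma norm_taylor_le {φ : H → ℝ} (hφ : ContDiff ℝ 2 φ) {M : ℝ}
    (hM : ∀ v, ‖fderiv ℝ (fderiv ℝ φ) v‖ ≤ M) (x y : H) :
    |φ (x + y) - φ x - fderiv ℝ φ x y| ≤ M * ‖y‖ ^ 2 := by
  have hd : Differentiable ℝ φ := hφ.differentiable (by norm_num)
  have hd2 : Differentiable ℝ (fderiv ℝ φ) :=
    (hφ.fderiv_right (m := 1) (by norm_num)).differentiable (by norm_num)
  have hL : ∀ z, ‖fderiv ℝ φ z - fderiv ℝ φ x‖ ≤ M * ‖z - x‖ := fun z =>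
    convex_univ.norm_image_sub_le_of_norm_fderiv_le (𝕜 := ℝ) (fun u _ => hd2 u)
      (fun u _ => hM u) (Set.mem_univ x) (Set.mem_univ z)
  have hM0 : 0 ≤ M := (norm_nonneg (fderiv ℝ (fderiv ℝ φ) x)).trans (hM x)
  have := (convex_segment x (x + y)).norm_image_sub_le_of_norm_fderiv_le' (𝕜 := ℝ) (f := φ)
    (φ := fderiv ℝ φ x) (C := M * ‖y‖) (fun u _ => hd u) (fun u hu => ?_)
    (left_mem_segment ℝ x (x + y)) (right_mem_segment ℝ x (x + y))
  · simp only [add_sub_cancel_left] at this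
    rw [Real.norm_eq_abs] at this
    linarith [this, sq ‖y‖]
  · refine (hL u).trans (mul_le_mul_of_nonneg_left ?_ hM0)
    have := norm_sub_le_of_mem_segment hu
    simpa using this

end WeakError

section WeakError

variable {H : Type*} [NormedAddCommGroup H] [InnerProductSpace ℝ H]
  [MeasurableSpace H] [BorelSpace H] [SecondCountableTopology H] {e : HilbertBasis ℕ ℝ H}

lemma integrable_comp_add_of_bounded_hessian {μ : Measure H} [IsProbabilityMeasure μ]
    (hμ : Integrable (fun x => ‖x‖ ^ 2) μ) {φ : H → ℝ} (hφ : ContDiff ℝ 2 φ) {M : ℝ}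
    (hM : ∀ v, ‖fderiv ℝ (fderiv ℝ φ) v‖ ≤ M) (x : H) : Integrable (fun y => φ (x + y)) μ := by
  have hg : Integrable (fun y : H => |φ x| + ‖fderiv ℝ φ x‖ * (1 + ‖y‖ ^ 2) + M * ‖y‖ ^ 2) μ :=
    ((integrable_const _).add (((integrable_const _).add hμ).const_mul _)).add (hμ.const_mul _)
  have hc := hφ.continuous
  refine hg.mono' (by fun_prop) (.of_forall fun y => ?_)
  have h1 := norm_taylor_le hφ hM x y
  have h2 : |fderiv ℝ φ x y| ≤ ‖fderiv ℝ φ x‖ * (1 + ‖y‖ ^ 2) :=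
    ((fderiv ℝ φ x).le_opNorm y).trans (mul_le_mul_of_nonneg_left
      (by nlinarith [sq_nonneg (‖y‖ - 1), norm_nonneg y]) (norm_nonneg _))
  rw [Real.norm_eq_abs]
  rw [abs_le] at *
  have h3 := le_abs_self (φ x)
  have h4 := neg_abs_le (φ x)
  constructor <;> linarith

lemma integrable_of_bounded_hessian {μ : Measure H} [IsProbabilityMeasure μ]
    (hμ : Integrable (fun x => ‖x‖ ^ 2) μ) {φ : H → ℝ} (hφ : ContDiff ℝ 2 φ) {M : ℝ}
    (hM : ∀ v, ‖fderiv ℝ (fderiv ℝ φ) v‖ ≤ M) : Integrable φ μ := by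
  simpa using integrable_comp_add_of_bounded_hessian hμ hφ hM 0

variable [CompleteSpace H]

/-- Adding an independent centered Gaussian increment changes the mean of `φ` by at most the
bound on the Hessian times the trace of the covariance of the increment. -/
lemma abs_integral_conv_sub_le {μ ν : Measure H} {v w : ℕ → ℝ} (hv0 : ∀ p, 0 ≤ v p)
    (hv : Summable v) (hw0 : ∀ p, 0 ≤ w p) (hw : Summable w) (hμ : HasDiagCov e v μ)
    (hν : HasDiagCov e w ν) {φ : H → ℝ} (hφ : ContDiff ℝ 2 φ) {M : ℝ}
    (hM : ∀ v, ‖fderiv ℝ (fderiv ℝ φ) v‖ ≤ M) :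
    |∫ x, φ x ∂(μ ∗ ν) - ∫ x, φ x ∂μ| ≤ M * ∑' p, w p := by
  have := hμ.1
  have := hν.1
  have hc := hμ.conv hv hw hν
  have hint := integrable_of_bounded_hessian
    (hc.integrable_norm_sq (fun p => add_nonneg (hv0 p) (hw0 p)) (hv.add hw)) hφ hM
  have hφi := integrable_of_bounded_hessian (hμ.integrable_norm_sq hv0 hv) hφ hM
  have hcont := hφ.continuous
  rw [integral_conv hint]
  have hint2 := (integrable_conv_iff hcont.aestronglyMeasurable).1 hint
  have hint3 : Integrable (fun x => ∫ y, φ (x + y) ∂ν) μ :=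
    hint2.2.mono' (by
      have : StronglyMeasurable fun z : H × H => φ (z.1 + z.2) :=
        (by fun_prop : Continuous fun z : H × H => φ (z.1 + z.2)).stronglyMeasurable
      exact this.integral_prod_right'.aestronglyMeasurable)
      (.of_forall fun x => norm_integral_le_integral_norm _)
  have hsq := hν.integrable_norm_sq hw0 hw
  have hid : ∀ L : H →L[ℝ] ℝ, Integrable (fun y => L y) ν := fun L => by
    refine (((integrable_const (1 : ℝ)).add hsq).const_mul ‖L‖).mono' (by fun_prop)
      (.of_forall fun y => (L.le_opNorm y).trans (mul_le_mul_of_nonneg_left ?_ (norm_nonneg _)))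
    simp only [Pi.add_apply]
    nlinarith [sq_nonneg (‖y‖ - 1), norm_nonneg y]
  -- Symmetry of `ν` kills the first-order Taylor term.
  have hodd : ∀ L : H →L[ℝ] ℝ, ∫ y, L y ∂ν = 0 := fun L => by
    have h1 : ∫ y, L y ∂ν = ∫ y, L (-y) ∂ν := by
      conv_lhs => rw [← hν.map_neg]
      exact integral_map measurable_neg.aemeasurable (by fun_prop)
    simp only [map_neg, integral_neg] at h1
    linarith
  rw [← integral_sub hint3 hφi]
  have hb : ∀ x, ‖∫ y, φ (x + y) ∂ν - φ x‖ ≤ M * ∑' p, w p := fun x => by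
    have hx := integrable_comp_add_of_bounded_hessian hsq hφ hM x
    have h1 : ∫ y, φ (x + y) ∂ν - φ x = ∫ y, (φ (x + y) - φ x - fderiv ℝ φ x y) ∂ν := by
      have h2 : Integrable (fun y => φ (x + y) - φ x) ν := hx.sub (integrable_const _)
      rw [integral_sub h2 (hid _), hodd, sub_zero, integral_sub hx (integrable_const _)]
      simp
    rw [h1, ← hν.integral_norm_sq hw0 hw, ← integral_const_mul]
    exact norm_integral_le_of_norm_le (hsq.const_mul M)
      (.of_forall fun y => norm_taylor_le hφ hM x y)
  simpa using norm_integral_le_of_norm_le_const (μ := μ) (.of_forall hb)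

/-- The weak error between two centered Gaussian laws with diagonal covariances. -/
lemma abs_integral_sub_integral_le {μ ν : Measure H} {v w : ℕ → ℝ} (hv0 : ∀ p, 0 ≤ v p)
    (hv : Summable v) (hw0 : ∀ p, 0 ≤ w p) (hw : Summable w) (hμ : HasDiagCov e v μ)
    (hν : HasDiagCov e w ν) {φ : H → ℝ} (hφ : ContDiff ℝ 2 φ) {M : ℝ}
    (hM : ∀ v, ‖fderiv ℝ (fderiv ℝ φ) v‖ ≤ M) :
    |∫ x, φ x ∂μ - ∫ x, φ x ∂ν| ≤ M * ∑' p, |v p - w p| := by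
  -- Both laws are the Gaussian law with variances `min v w` convolved with a Gaussian increment;
  -- the traces of the two increments add up to `∑ |v - w|`.
  have hm0 : ∀ p, 0 ≤ min (v p) (w p) := fun p => le_min (hv0 p) (hw0 p)
  have hm : Summable fun p => min (v p) (w p) :=
    Summable.of_nonneg_of_le hm0 (fun p => min_le_left _ _) hv
  have hvm := hv.sub hm
  have hwm := hw.sub hm
  have hvm0 : ∀ p, 0 ≤ v p - min (v p) (w p) := fun p => sub_nonneg.2 (min_le_left _ _)
  have hwm0 : ∀ p, 0 ≤ w p - min (v p) (w p) := fun p => sub_nonneg.2 (min_le_right _ _)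
  obtain ⟨κ, hκ⟩ := exists_hasDiagCov e hm0 hm
  obtain ⟨ν₁, hν₁⟩ := exists_hasDiagCov e hvm0 hvm
  obtain ⟨ν₂, hν₂⟩ := exists_hasDiagCov e hwm0 hwm
  have h1 := abs_integral_conv_sub_le hm0 hm hvm0 hvm hκ hν₁ hφ hM
  have h2 := abs_integral_conv_sub_le hm0 hm hwm0 hwm hκ hν₂ hφ hM
  have e1 : κ ∗ ν₁ = μ := HasDiagCov.unique (by simpa using hκ.conv hm hvm hν₁) hμ
  have e2 : κ ∗ ν₂ = ν := HasDiagCov.unique (by simpa using hκ.conv hm hwm hν₂) hν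
  rw [e1] at h1
  rw [e2] at h2
  have h3 : ∑' p, |v p - w p| =
      ∑' p, (v p - min (v p) (w p)) + ∑' p, (w p - min (v p) (w p)) := by
    rw [← hvm.tsum_add hwm]
    congr 1
    ext p
    rcases le_total (v p) (w p) with h | h
    · rw [min_eq_left h, abs_of_nonpos (by linarith)]; ring
    · rw [min_eq_right h, abs_of_nonneg (by linarith)]; ring
  rw [h3, mul_add]
  calc _ = |(∫ x, φ x ∂μ - ∫ x, φ x ∂κ) - (∫ x, φ x ∂ν - ∫ x, φ x ∂κ)| := by ring_nf
    _ ≤ _ := (abs_sub _ _).trans (add_le_add h1 h2)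

end WeakError

/-! ### Diagonal operators -/

section Diag

variable {H : Type*} [NormedAddCommGroup H] [InnerProductSpace ℝ H] {e : HilbertBasis ℕ ℝ H}

lemma ext_inner_basis (e : HilbertBasis ℕ ℝ H) {x y : H} (h : ∀ p, ⟪e p, x⟫ = ⟪e p, y⟫) :
    x = y := by
  refine e.repr.injective (lp.ext (funext fun p => ?_))
  rw [e.repr_apply_apply, e.repr_apply_apply, h]

lemma hasSum_diag (e : HilbertBasis ℕ ℝ H) {a : ℕ → ℝ} {C : ℝ} (hC : ∀ p, |a p| ≤ C) (u : H) :
    ∃ y, HasSum (fun p => (a p * ⟪e p, u⟫) • e p) y ∧ ∀ p, ⟪e p, y⟫ = a p * ⟪e p, u⟫ := by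
  have hmem : Memℓp (fun p => a p * ⟪e p, u⟫) 2 := by
    rw [memℓp_gen_iff (by norm_num)]
    refine (((hasSum_inner_sq e u).summable.mul_left (C ^ 2)).of_nonneg_of_le
      (fun p => by positivity) fun p => ?_)
    simp only [ENNReal.toReal_ofNat, Real.rpow_ofNat, norm_mul, mul_pow, Real.norm_eq_abs]
    rw [sq_abs ⟪e p, u⟫]
    exact mul_le_mul_of_nonneg_right (pow_le_pow_left₀ (abs_nonneg _) (hC p) 2) (sq_nonneg _)
  refine ⟨e.repr.symm ⟨_, hmem⟩, e.hasSum_repr_symm ⟨_, hmem⟩, fun p => ?_⟩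
  rw [← e.repr_apply_apply, LinearIsometryEquiv.apply_symm_apply]

lemma inner_tsum_diag (e : HilbertBasis ℕ ℝ H) {a : ℕ → ℝ} {C : ℝ} (hC : ∀ p, |a p| ≤ C) (u : H)
    (p : ℕ) : ⟪e p, ∑' p, (a p * ⟪e p, u⟫) • e p⟫ = a p * ⟪e p, u⟫ := by
  obtain ⟨y, hy, hy2⟩ := hasSum_diag e hC u
  rw [hy.tsum_eq, hy2]

lemma inner_spectralOp (e : HilbertBasis ℕ ℝ H) {lam : ℕ → ℝ} {f : ℝ → ℝ} {C : ℝ}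
    (hC : ∀ p, |f (lam p)| ≤ C) (u : H) (p : ℕ) :
    ⟪e p, spectralOp e lam f u⟫ = f (lam p) * ⟪e p, u⟫ :=
  inner_tsum_diag e hC u p

lemma norm_le_of_inner_diag {a : ℕ → ℝ} {C : ℝ} (hC : ∀ p, |a p| ≤ C) {u y : H}
    (hy : ∀ p, ⟪e p, y⟫ = a p * ⟪e p, u⟫) : ‖y‖ ≤ C * ‖u‖ := by
  have hC0 : 0 ≤ C := (abs_nonneg _).trans (hC 0)
  refine le_of_sq_le_sq ?_ (by positivity)
  rw [mul_pow]
  refine hasSum_le (fun p => ?_) (hasSum_inner_sq e y) ((hasSum_inner_sq e u).mul_left (C ^ 2))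
  rw [hy, mul_pow, ← sq_abs (a p)]
  exact mul_le_mul_of_nonneg_right (pow_le_pow_left₀ (abs_nonneg _) (hC p) 2) (sq_nonneg _)

lemma exists_diagOp (e : HilbertBasis ℕ ℝ H) {a : ℕ → ℝ} {C : ℝ} (hC : ∀ p, |a p| ≤ C) :
    ∃ S : H →L[ℝ] H, ∀ x p, ⟪e p, S x⟫ = a p * ⟪e p, x⟫ := by
  have hT := inner_tsum_diag e hC
  let T : H →ₗ[ℝ] H :=
    { toFun := fun u => ∑' p, (a p * ⟪e p, u⟫) • e p
      map_add' := fun x y => ext_inner_basis e fun p => by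
        rw [inner_add_right, hT, hT, hT, inner_add_right, mul_add]
      map_smul' := fun c x => ext_inner_basis e fun p => by
        rw [RingHom.id_apply, inner_smul_right, hT, hT, inner_smul_right]; ring }
  exact ⟨T.mkContinuous C fun x => norm_le_of_inner_diag hC (hT x), hT⟩

lemma inner_diag_comm {S : H →L[ℝ] H} {a : ℕ → ℝ} (hS : ∀ x p, ⟪e p, S x⟫ = a p * ⟪e p, x⟫)
    (x y : H) : ⟪S x, y⟫ = ⟪x, S y⟫ := by
  rw [← e.tsum_inner_mul_inner, ← e.tsum_inner_mul_inner]
  congr 1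
  ext p
  rw [hS, real_inner_comm, hS, real_inner_comm x]
  ring

/-- The factors are not assumed bounded away from 1 in absolute value. Dominated convergence in
Parseval's series still gives strong convergence, which is all that uniqueness needs. -/
lemma tendsto_iterate_diag {S : H →L[ℝ] H} {a : ℕ → ℝ} (hS : ∀ x p, ⟪e p, S x⟫ = a p * ⟪e p, x⟫)
    (ha : ∀ p, |a p| < 1) (x : H) : Tendsto (fun n => S^[n] x) atTop (𝓝 0) := by
  have h1 : ∀ n p, ⟪e p, S^[n] x⟫ = a p ^ n * ⟪e p, x⟫ := by
    intro n
    induction n with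
    | zero => simp
    | succ n ih => intro p; rw [Function.iterate_succ_apply', hS, ih]; ring
  have h2 : Tendsto (fun n => ‖S^[n] x‖ ^ 2) atTop (𝓝 0) := by
    simp_rw [← fun y => (hasSum_inner_sq e y).tsum_eq, h1]
    have := tendsto_tsum_of_dominated_convergence (𝓕 := atTop)
      (f := fun (n : ℕ) p => (a p ^ n * ⟪e p, x⟫) ^ 2) (g := fun _ => 0)
      (hasSum_inner_sq e x).summable (fun p => ?_) (.of_forall fun n p => ?_)
    · simpa using this
    · simpa using ((tendsto_pow_atTop_nhds_zero_of_abs_lt_one (ha p)).mul_const ⟪e p, x⟫).pow 2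
    · rw [Real.norm_of_nonneg (sq_nonneg _), mul_pow, ← pow_mul, mul_comm n, pow_mul, ← sq_abs (a p),
        ← pow_mul]
      exact mul_le_of_le_one_left (sq_nonneg _) (pow_le_one₀ (abs_nonneg _) (ha p).le)
  rw [tendsto_zero_iff_norm_tendsto_zero]
  have := h2.sqrt
  simpa using this

lemma tsum_stationary {a v w : ℕ → ℝ} {S : H →L[ℝ] H} (hS : ∀ x p, ⟪e p, S x⟫ = a p * ⟪e p, x⟫)
    (hv : Summable v) (hw : ∀ p, w p = (1 - a p ^ 2) * v p) (ξ : H) :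
    ∑' p, w p * ⟪e p, ξ⟫ ^ 2 = ∑' p, v p * ⟪e p, ξ⟫ ^ 2 - ∑' p, v p * ⟪e p, S ξ⟫ ^ 2 := by
  rw [← (summable_mul_inner_sq_of_summable hv e ξ).tsum_sub
    (summable_mul_inner_sq_of_summable hv e (S ξ))]
  congr 1
  ext p
  rw [hS, hw]
  ring

end Diag

/-! ### Stationary laws of diagonal autoregressions -/

section AutoRegression

lemma charFun_bind {H : Type*} [NormedAddCommGroup H] [InnerProductSpace ℝ H]
    [MeasurableSpace H] [BorelSpace H] {X : Type*} [MeasurableSpace X] (μ : Measure X) [IsProbabilityMeasure μ]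
    (K : Kernel X H) [IsMarkovKernel K] (ξ : H) :
    charFun (μ.bind K) ξ = ∫ x, charFun (K x) ξ ∂μ := by
  have hf : Continuous fun y : H => Complex.exp ((⟪y, ξ⟫ : ℝ) * Complex.I) := by fun_prop
  simp_rw [charFun_apply]
  rw [← Measure.snd_compProd, Measure.snd, integral_map measurable_snd.aemeasurable
    hf.aestronglyMeasurable, Measure.integral_compProd]
  refine Integrable.of_bound (C := 1) (hf.measurable.comp measurable_snd).aestronglyMeasurable
    (.of_forall fun z => ?_)
  rw [Complex.norm_exp_ofReal_mul_I]

variable {H : Type*} [NormedAddCommGroup H] [InnerProductSpace ℝ H]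
  [MeasurableSpace H] [BorelSpace H] [SecondCountableTopology H]
  {e : HilbertBasis ℕ ℝ H}

lemma charFun_bind_autoRegression {H : Type*} [NormedAddCommGroup H] [InnerProductSpace ℝ H]
    [MeasurableSpace H] [BorelSpace H] {e : HilbertBasis ℕ ℝ H} {w : ℕ → ℝ} {K : Kernel H H}
    {μ : Measure H} {S : H →L[ℝ] H} [IsProbabilityMeasure μ] [IsMarkovKernel K]
    (h : ∀ x ξ, charFun (K x) ξ = Complex.exp ((⟪x, S ξ⟫ : ℝ) * Complex.I) *
      (Real.exp (-(∑' p, w p * ⟪e p, ξ⟫ ^ 2) / 2) : ℝ)) (ξ : H) :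
    charFun (μ.bind K) ξ = charFun μ (S ξ) * (Real.exp (-(∑' p, w p * ⟪e p, ξ⟫ ^ 2) / 2) : ℝ) := by
  rw [charFun_bind]
  simp_rw [h]
  rw [integral_mul_const, charFun_apply]

/-- The transition kernel of the vector autoregression `x ↦ S x + w`, with `S` diagonal and `w` a
centered Gaussian variable of diagonal covariance `w`. -/
def IsDiagAutoRegression (e : HilbertBasis ℕ ℝ H) (a w : ℕ → ℝ) (K : Kernel H H) : Prop :=
  IsMarkovKernel K ∧ ∃ S : H →L[ℝ] H, (∀ x p, ⟪e p, S x⟫ = a p * ⟪e p, x⟫) ∧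
    ∀ x ξ, charFun (K x) ξ = Complex.exp ((⟪x, S ξ⟫ : ℝ) * Complex.I) *
      (Real.exp (-(∑' p, w p * ⟪e p, ξ⟫ ^ 2) / 2) : ℝ)

variable {a v w : ℕ → ℝ} {K : Kernel H H} {μ : Measure H}

lemma IsDiagAutoRegression.invariant [CompleteSpace H] (hK : IsDiagAutoRegression e a w K) (hv : Summable v)
    (hw : ∀ p, w p = (1 - a p ^ 2) * v p) (hμ : HasDiagCov e v μ) : K.Invariant μ := by
  obtain ⟨hK1, S, hS, hK⟩ := hK
  have := hμ.1
  refine HasDiagCov.unique (e := e) (v := v) ⟨inferInstance, fun ξ => ?_⟩ hμ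
  rw [charFun_bind_autoRegression hK, hμ.2, tsum_stationary hS hv hw, ← Complex.ofReal_mul, ← Real.exp_add]
  ring_nf

lemma IsDiagAutoRegression.hasDiagCov_of_invariant (hK : IsDiagAutoRegression e a w K)
    (hv : Summable v) (hw : ∀ p, w p = (1 - a p ^ 2) * v p) (ha : ∀ p, |a p| < 1)
    (hμ1 : IsProbabilityMeasure μ) (hμ : K.Invariant μ) : HasDiagCov e v μ := by
  obtain ⟨hK1, S, hS, hK⟩ := hK
  refine ⟨hμ1, fun ξ => ?_⟩
  set V : H → ℝ := fun ξ => ∑' p, v p * ⟪e p, ξ⟫ ^ 2 with hV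
  have hstep : ∀ ξ, charFun μ ξ = charFun μ (S ξ) * (Real.exp (-(V ξ - V (S ξ)) / 2) : ℝ) := by
    intro ξ
    conv_lhs => rw [← hμ.def]
    rw [charFun_bind_autoRegression hK, tsum_stationary hS hv hw]
  -- The exponents telescope. Along `S^[n] ξ → 0` the characteristic function tends to 1 by
  -- continuity, so no moment of `μ` is required.
  have hn : ∀ n, charFun μ ξ =
      charFun μ (S^[n] ξ) * (Real.exp (-(V ξ - V (S^[n] ξ)) / 2) : ℝ) := by
    intro n
    induction n with
    | zero => simp
    | succ n ih =>
      rw [ih, hstep (S^[n] ξ), ← Function.iterate_succ_apply' S, mul_assoc, ← Complex.ofReal_mul,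
        ← Real.exp_add]
      congr 3
      ring
  have hlim := tendsto_iterate_diag hS ha ξ
  obtain ⟨C, hC⟩ := exists_abs_le_of_summable hv
  have hVlim : Tendsto (fun n => V (S^[n] ξ)) atTop (𝓝 0) := by
    have h0 : Tendsto (fun n => C * ‖S^[n] ξ‖ ^ 2) atTop (𝓝 0) := by
      simpa using (hlim.norm.pow 2).const_mul C
    refine squeeze_zero_norm (fun n => ?_) h0
    have hsq := hasSum_inner_sq e (S^[n] ξ)
    refine tsum_of_norm_bounded (hsq.mul_left C) fun p => ?_
    rw [norm_mul, Real.norm_eq_abs, Real.norm_of_nonneg (sq_nonneg _)]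
    exact mul_le_mul_of_nonneg_right (hC p) (sq_nonneg _)
  have hlim2 : Tendsto (fun n => charFun μ (S^[n] ξ) *
      (Real.exp (-(V ξ - V (S^[n] ξ)) / 2) : ℝ)) atTop
      (𝓝 (1 * (Real.exp (-(V ξ - 0) / 2) : ℝ))) := by
    refine Tendsto.mul ?_ ((Complex.continuous_ofReal.tendsto _).comp
      ((Real.continuous_exp.tendsto _).comp (((hVlim.const_sub _).neg).div_const 2)))
    have := (continuous_charFun (μ := μ)).tendsto 0
    rw [charFun_zero] at this
    simpa [Function.comp_def] using this.comp hlim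
  have := tendsto_nhds_unique (tendsto_const_nhds.congr hn) hlim2
  simpa using this

end AutoRegression

/-! ### Riemann sums and variation of constants along a path -/

section Deterministic

/-- Convergence of tagged Riemann sums on uniform partitions. -/
lemma tendsto_riemann_sum {g F : ℝ → ℝ} (hg : Continuous g) (hF : Continuous F) {t : ℝ}
    (ht : 0 ≤ t) {θ : ℝ} (hθ : θ ∈ Set.Icc (0 : ℝ) 1) :
    Tendsto (fun n : ℕ => ∑ k ∈ Finset.range n, g (((k : ℝ) + θ) * t / n) *
      ∫ r in ((k : ℝ) * t / n)..(((k : ℝ) + 1) * t / n), F r) atTop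
      (𝓝 (∫ r in (0 : ℝ)..t, g r * F r)) := by
  rw [Metric.tendsto_atTop]
  intro ε hε
  set I := ∫ r in (0 : ℝ)..t, |F r| with hI
  have hI0 : 0 ≤ I := intervalIntegral.integral_nonneg ht fun r _ => abs_nonneg _
  have huc := (isCompact_Icc (a := (0 : ℝ)) (b := t)).uniformContinuousOn_of_continuous
    hg.continuousOn
  rw [Metric.uniformContinuousOn_iff] at huc
  obtain ⟨δ, hδ, huc⟩ := huc (ε / (I + 1)) (by positivity)
  obtain ⟨N, hN⟩ := exists_nat_gt (t / δ)
  refine ⟨N + 1, fun n hn => ?_⟩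
  have hn0 : (0 : ℝ) < n := by exact_mod_cast (by omega : 0 < n)
  have hmesh : t / n < δ := by
    rw [div_lt_iff₀ hn0]
    rw [div_lt_iff₀ hδ] at hN
    have : (N : ℝ) ≤ n := by exact_mod_cast (by omega : N ≤ n)
    nlinarith
  have hint : ∀ {h : ℝ → ℝ}, Continuous h → ∫ r in (0 : ℝ)..t, h r =
      ∑ k ∈ Finset.range n, ∫ r in ((k : ℝ) * t / n)..(((k : ℝ) + 1) * t / n), h r := by
    intro h hh
    have := intervalIntegral.sum_integral_adjacent_intervals (μ := volume) (f := h)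
      (a := fun k : ℕ => (k : ℝ) * t / n) (n := n) (fun k _ => hh.intervalIntegrable _ _)
    simp only [Nat.cast_zero, zero_mul, zero_div, mul_div_cancel_left₀ t hn0.ne'] at this
    rw [← this]
    simp
  have hcF : ∀ c : ℝ, Continuous fun r => c * F r := fun c => by fun_prop
  have hgF : Continuous fun r => g r * F r := hg.mul hF
  rw [hint hgF, Real.dist_eq, ← Finset.sum_sub_distrib]
  have hbound : ∀ k ∈ Finset.range n, |g (((k : ℝ) + θ) * t / n) *
      (∫ r in ((k : ℝ) * t / n)..(((k : ℝ) + 1) * t / n), F r) -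
        ∫ r in ((k : ℝ) * t / n)..(((k : ℝ) + 1) * t / n), g r * F r| ≤
      ε / (I + 1) * ∫ r in ((k : ℝ) * t / n)..(((k : ℝ) + 1) * t / n), |F r| := by
    intro k hk
    have hkn : (k : ℝ) + 1 ≤ n := by exact_mod_cast Finset.mem_range.1 hk
    have hab : (k : ℝ) * t / n ≤ ((k : ℝ) + 1) * t / n := by gcongr; linarith
    have h0 : 0 ≤ (k : ℝ) * t / n := by positivity
    have h1 : ((k : ℝ) + 1) * t / n ≤ t := by
      rw [div_le_iff₀ hn0]; nlinarith
    have hτ1 : (k : ℝ) * t / n ≤ ((k : ℝ) + θ) * t / n := by gcongr; linarith [hθ.1]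
    have hτ2 : ((k : ℝ) + θ) * t / n ≤ ((k : ℝ) + 1) * t / n := by gcongr; exact hθ.2
    have hlen : ((k : ℝ) + 1) * t / n - (k : ℝ) * t / n = t / n := by ring
    rw [← intervalIntegral.integral_const_mul, ← intervalIntegral.integral_const_mul,
      ← intervalIntegral.integral_sub ((hcF _).intervalIntegrable _ _)
        (hgF.intervalIntegrable _ _)]
    rw [← Real.norm_eq_abs]
    refine intervalIntegral.norm_integral_le_of_norm_le hab (.of_forall fun r hr => ?_)
      ((continuous_const.mul hF.abs).intervalIntegrable _ _)
    rw [← sub_mul, norm_mul, Real.norm_eq_abs (F r)]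
    refine mul_le_mul_of_nonneg_right ?_ (abs_nonneg _)
    have := huc (((k : ℝ) + θ) * t / n) ⟨by linarith, by linarith⟩ r
      ⟨by linarith [hr.1], by linarith [hr.2]⟩ (by
        rw [Real.dist_eq, abs_lt]; constructor <;> linarith [hr.1, hr.2])
    rw [Real.dist_eq] at this
    exact this.le
  refine ((Finset.abs_sum_le_sum_abs _ _).trans (Finset.sum_le_sum hbound)).trans_lt ?_
  rw [← Finset.mul_sum, ← hint hF.abs, ← hI, div_mul_eq_mul_div, div_lt_iff₀ (by positivity)]
  nlinarith

/-- Pathwise limit of the Riemann–Itô sums of `e^{-(t-r)c}` against a continuous path. -/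
lemma tendsto_riemann_ito_exp {g : ℝ → ℝ} (hg : Continuous g) (c : ℝ) {t : ℝ} (ht : 0 ≤ t) :
    Tendsto (fun n : ℕ => ∑ k ∈ Finset.range n, Real.exp (-(t - (k : ℝ) * t / n) * c) *
      (g (((k : ℝ) + 1) * t / n) - g ((k : ℝ) * t / n))) atTop
      (𝓝 (g t - Real.exp (-t * c) * g 0 -
        c * ∫ r in (0 : ℝ)..t, Real.exp (-(t - r) * c) * g r)) := by
  set f : ℝ → ℝ := fun r => Real.exp (-(t - r) * c) with hf
  have hfc : Continuous f := by fun_prop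
  have hd : ∀ r, HasDerivAt f (c * f r) r := fun r => by
    have h1 : HasDerivAt (fun r => -(t - r) * c) c r := by
      simpa using (((hasDerivAt_id r).const_sub t).neg.mul_const c)
    simpa [hf, mul_comm] using h1.exp
  -- Summation by parts moves the increments onto the smooth exponential; the path is then sampled
  -- at right end points, hence `θ := 1`.
  have hlim := tendsto_riemann_sum hg (continuous_const.mul hfc) (F := fun r => c * f r) ht
    (θ := 1) ⟨zero_le_one, le_rfl⟩
  have hint : ∀ a b, ∫ r in a..b, c * f r = f b - f a := fun a b =>
    intervalIntegral.integral_eq_sub_of_hasDerivAt (fun r _ => hd r)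
      ((continuous_const.mul hfc).intervalIntegrable _ _)
  have h3 : ∫ r in (0 : ℝ)..t, g r * (c * f r) = c * ∫ r in (0 : ℝ)..t, f r * g r := by
    rw [← intervalIntegral.integral_const_mul]
    congr 1
    ext r
    ring
  rw [h3] at hlim
  refine ((tendsto_const_nhds (x := f t * g t - f 0 * g 0)).sub hlim).congr' ?_ |>.trans ?_
  · filter_upwards [eventually_gt_atTop 0] with n hn
    have hn0 : (n : ℝ) ≠ 0 := by exact_mod_cast hn.ne'
    have htel := Finset.sum_range_sub (fun k : ℕ => f ((k : ℝ) * t / n) * g ((k : ℝ) * t / n)) n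
    simp only [Nat.cast_zero, zero_mul, zero_div, mul_div_cancel_left₀ t hn0] at htel
    rw [← htel, ← Finset.sum_sub_distrib]
    refine Finset.sum_congr rfl fun k _ => ?_
    rw [hint]
    push_cast
    ring
  · simp [hf]

/-- Variation of constants for a scalar linear integral equation with an additive path. -/
lemma eq_of_mild_equation {y w : ℝ → ℝ} (hy : Continuous y) (hw : Continuous w)
    {lam b x s : ℝ}
    (h : ∀ t, 0 ≤ t → y t = Real.exp (-t * lam) * x
      - b * (∫ r in (0 : ℝ)..t, Real.exp (-(t - r) * lam) * y r)
      + s * (w t - lam * ∫ r in (0 : ℝ)..t, Real.exp (-(t - r) * lam) * w r))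
    {t : ℝ} (ht : 0 ≤ t) :
    y t = Real.exp (-t * (lam + b)) * x
      + s * (w t - (lam + b) * ∫ r in (0 : ℝ)..t, Real.exp (-(t - r) * (lam + b)) * w r) := by
  have hpull : ∀ (c : ℝ) (g : ℝ → ℝ) (t : ℝ), ∫ r in (0 : ℝ)..t, Real.exp (-(t - r) * c) * g r =
      Real.exp (-t * c) * ∫ r in (0 : ℝ)..t, Real.exp (r * c) * g r := by
    intro c g t
    rw [← intervalIntegral.integral_const_mul]
    congr 1
    ext r
    rw [← mul_assoc, ← Real.exp_add]
    ring_nf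
  set c := lam + b with hc
  have hder : ∀ (d : ℝ) (g : ℝ → ℝ), Continuous g → ∀ t,
      HasDerivAt (fun t => ∫ r in (0 : ℝ)..t, Real.exp (r * d) * g r) (Real.exp (t * d) * g t) t :=
    fun d g hg t => by
      have hcont : Continuous fun r => Real.exp (r * d) * g r := by fun_prop
      exact intervalIntegral.integral_hasDerivAt_right (hcont.intervalIntegrable _ _)
        hcont.stronglyMeasurable.stronglyMeasurableAtFilter hcont.continuousAt
  have hexp : ∀ d t : ℝ, HasDerivAt (fun t => Real.exp (t * d)) (Real.exp (t * d) * d) t :=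
    fun d t => by simpa using ((hasDerivAt_id t).mul_const d).exp
  -- The paths `y` and `w` need not be differentiable, but the bracket is built from integrals, and
  -- for `t ≥ 0` the mild equation makes it equal to `e^{t lam} (y - s w)`. Thus `Z` is the
  -- conserved quantity `e^{tc} (y - s w) + s c ∫ e^{rc} w`, written in a form that can be
  -- differentiated.
  set Z : ℝ → ℝ := fun t => Real.exp (t * b) * (x - b * (∫ r in (0 : ℝ)..t, Real.exp (r * lam) * y r)
    - s * lam * ∫ r in (0 : ℝ)..t, Real.exp (r * lam) * w r) +
      s * c * ∫ r in (0 : ℝ)..t, Real.exp (r * c) * w r with hZ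
  have hY : ∀ t, 0 ≤ t → x - b * (∫ r in (0 : ℝ)..t, Real.exp (r * lam) * y r)
    - s * lam * (∫ r in (0 : ℝ)..t, Real.exp (r * lam) * w r) =
      Real.exp (t * lam) * (y t - s * w t) := by
    intro t ht
    rw [h t ht, hpull, hpull]
    have he : Real.exp (t * lam) * Real.exp (-t * lam) = 1 := by
      rw [← Real.exp_add]; simp
    linear_combination (-(x - b * (∫ r in (0 : ℝ)..t, Real.exp (r * lam) * y r)
      - s * lam * (∫ r in (0 : ℝ)..t, Real.exp (r * lam) * w r))) * he
  have hZd : ∀ t, HasDerivAt Z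
      (Real.exp (t * b) * b * (x - b * (∫ r in (0 : ℝ)..t, Real.exp (r * lam) * y r)
        - s * lam * ∫ r in (0 : ℝ)..t, Real.exp (r * lam) * w r) +
       Real.exp (t * b) * (- (b * (Real.exp (t * lam) * y t))
        - s * lam * (Real.exp (t * lam) * w t)) + s * c * (Real.exp (t * c) * w t)) t := by
    intro t
    refine (((hexp b t).mul ((((hder lam y hy t).const_mul b).const_sub x).sub
      ((hder lam w hw t).const_mul (s * lam)))).add ((hder c w hw t).const_mul (s * c)))
  have hsplit : ∀ t, Real.exp (t * c) = Real.exp (t * b) * Real.exp (t * lam) := fun t => by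
    rw [← Real.exp_add, hc]; ring_nf
  have hconst := constant_of_has_deriv_right_zero (f := Z) (a := 0) (b := t)
    (fun r _ => (hZd r).continuousAt.continuousWithinAt) (fun r hr => by
      have := (hZd r).hasDerivWithinAt (s := Set.Ici r)
      rw [hY r hr.1] at this
      convert this using 1
      rw [hsplit, hc]
      ring) t ⟨ht, le_rfl⟩
  have hZ0 : Z 0 = x := by simp [hZ]
  have hZt : Z t = Real.exp (t * c) * (y t - s * w t) +
      s * c * ∫ r in (0 : ℝ)..t, Real.exp (r * c) * w r := by
    rw [hZ]
    simp only
    rw [hY t ht, hsplit]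
    ring
  rw [hZ0, hZt] at hconst
  rw [hpull]
  have he : Real.exp (-t * c) * Real.exp (t * c) = 1 := by
    rw [← Real.exp_add]; simp
  linear_combination Real.exp (-t * c) * hconst - (y t - s * w t) * he

end Deterministic

/-! ### Wiener integrals as pathwise functionals -/

section Brownian

variable {Ω : Type*} [MeasurableSpace Ω] {P : Measure Ω}

/-- The Riemann–Itô sum of `f` against the path `x` on the uniform partition of `[0, t]`. -/
noncomputable def itoSum (f : ℝ → ℝ) (t : ℝ≥0) (n : ℕ) (x : ℝ≥0 → ℝ) : ℝ :=
  ∑ k ∈ Finset.range n, f ((k : ℝ) * t / n) *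
    (x (((k : ℝ≥0) + 1) * t / n) - x ((k : ℝ≥0) * t / n))

lemma measurable_itoSum (f : ℝ → ℝ) (t : ℝ≥0) (n : ℕ) : Measurable (itoSum f t n) := by
  unfold itoSum
  refine Finset.measurable_fun_sum _ fun k _ => Measurable.const_mul ?_ _
  exact (measurable_pi_apply _).sub (measurable_pi_apply _)

/-- The sum is a linear combination of independent Gaussian increments of variance `t / n`, so the
exponent contains a Riemann sum for the integral of `f ^ 2`. -/
lemma charFun_itoSum [IsProbabilityMeasure P] {w : ℝ≥0 → Ω → ℝ} (hw : IsPreBrownianReal w P)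
    (f : ℝ → ℝ) (t : ℝ≥0) (n : ℕ) (θ : ℝ) :
    charFun (P.map fun ω => itoSum f t n fun s => w s ω) θ =
      (Real.exp (-(θ ^ 2 * ∑ k ∈ Finset.range n, f ((k : ℝ) * t / n) ^ 2 * (t / n)) / 2) : ℝ) := by
  have hmono : Monotone fun i : Fin (n + 1) => ((i : ℕ) : ℝ≥0) * t / n := by
    intro i j hij
    have : ((i : ℕ) : ℝ≥0) ≤ ((j : ℕ) : ℝ≥0) := by exact_mod_cast hij
    simp only
    gcongr
  have hind := hw.hasIndepIncrements n _ hmono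
  have hind2 := hind.comp (fun i x => f (((i : ℕ) : ℝ) * t / n) * x) fun i => by fun_prop
  have hmeas : ∀ s, AEMeasurable (w s) P := hw.aemeasurable
  have hprod := congrFun (hind2.charFun_map_fun_sum_eq_prod fun i => by
    exact (((hmeas _).sub (hmeas _)).const_mul _)) θ
  have hsum : (fun ω => itoSum f t n fun s => w s ω) = fun ω => ∑ i : Fin n,
      ((fun x => f (((i : ℕ) : ℝ) * t / n) * x) ∘ fun ω =>
        w (((i.succ : ℕ) : ℝ≥0) * t / n) ω - w (((i.castSucc : ℕ) : ℝ≥0) * t / n) ω) ω := by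
    ext ω
    rw [itoSum, Finset.sum_range]
    refine Finset.sum_congr rfl fun i _ => ?_
    simp
  rw [hsum, hprod, Finset.prod_apply]
  have hfac : ∀ i : Fin n, charFun (P.map ((fun x => f (((i : ℕ) : ℝ) * t / n) * x) ∘ fun ω =>
        w (((i.succ : ℕ) : ℝ≥0) * t / n) ω - w (((i.castSucc : ℕ) : ℝ≥0) * t / n) ω)) θ =
      (Real.exp (-(θ ^ 2 * (f (((i : ℕ) : ℝ) * t / n) ^ 2 * (t / n))) / 2) : ℝ) := by
    intro i
    have hn : (n : ℝ≥0) ≠ 0 := by exact_mod_cast (i.pos).ne'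
    have hlaw := hw.hasLaw_sub (((i.succ : ℕ) : ℝ≥0) * t / n) (((i.castSucc : ℕ) : ℝ≥0) * t / n)
    rw [Function.comp_def, charFun_map_mul_comp (show AEMeasurable (fun ω => w (((i.succ : ℕ) : ℝ≥0) * t / n) ω -
      w (((i.castSucc : ℕ) : ℝ≥0) * t / n) ω) P from (hmeas _).sub (hmeas _))]
    have h3 : nndist (((i.succ : ℕ) : ℝ≥0) * t / n).1 (((i.castSucc : ℕ) : ℝ≥0) * t / n).1 =
        t / n := by
      refine NNReal.eq ?_
      rw [coe_nndist, Real.dist_eq]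
      change |((((i.succ : ℕ) : ℝ≥0) * t / n : ℝ≥0) : ℝ) -
        ((((i.castSucc : ℕ) : ℝ≥0) * t / n : ℝ≥0) : ℝ)| = _
      push_cast [Fin.val_succ, Fin.val_castSucc]
      rw [show ((i : ℕ) + 1 : ℝ) * t / n - (i : ℕ) * t / n = t / n by ring]
      exact abs_of_nonneg (by positivity)
    have h2 : P.map (fun ω => w (((i.succ : ℕ) : ℝ≥0) * t / n) ω -
        w (((i.castSucc : ℕ) : ℝ≥0) * t / n) ω) = gaussianReal 0 (t / n) := by
      rw [← h3]
      exact hlaw.map_eq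
    rw [h2, charFun_gaussianReal,
      show ∀ z : ℝ≥0, ((z : ℝ≥0) : ℂ) = (((z : ℝ≥0) : ℝ) : ℂ) from fun z => rfl]
    push_cast
    congr 1
    ring
  simp_rw [hfac]
  rw [← Complex.ofReal_prod, ← Real.exp_sum, Finset.sum_range, Finset.mul_sum]
  congr 2
  rw [← Finset.sum_div, Finset.sum_neg_distrib]

lemma itoSum_extend (f : ℝ → ℝ) (t : ℝ≥0) (n : ℕ) (x : ℝ≥0 → ℝ) :
    itoSum f t n x = ∑ k ∈ Finset.range n, f ((k : ℝ) * t / n) *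
      (x ((((k : ℝ) + 1) * t / n).toNNReal) - x (((k : ℝ) * t / n).toNNReal)) := by
  refine Finset.sum_congr rfl fun k _ => ?_
  have h1 : (((k : ℝ) + 1) * t / n).toNNReal = ((k : ℝ≥0) + 1) * t / n := by
    rw [← Real.toNNReal_coe (r := ((k : ℝ≥0) + 1) * t / n)]; push_cast; rfl
  have h2 : ((k : ℝ) * t / n).toNNReal = (k : ℝ≥0) * t / n := by
    rw [← Real.toNNReal_coe (r := (k : ℝ≥0) * t / n)]; push_cast; rfl
  rw [h1, h2]

/-- Pathwise form `x(t) - c ∫_0^t e^{-(t-r)c} x(r) dr` of the Wiener integral of `e^{-(t-r)c}`. -/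
noncomputable def pathConv (c : ℝ) (x : ℝ≥0 → ℝ) (t : ℝ) : ℝ :=
  x t.toNNReal - c * ∫ r in (0 : ℝ)..t, Real.exp (-(t - r) * c) * x r.toNNReal

lemma tendsto_itoSum_pathConv {x : ℝ≥0 → ℝ} (hx : Continuous x) (hx0 : x 0 = 0) (c : ℝ) (t : ℝ≥0) :
    Tendsto (fun n => itoSum (fun r => Real.exp (-((t : ℝ) - r) * c)) t n x) atTop
      (𝓝 (pathConv c x t)) := by
  have h := tendsto_riemann_ito_exp (g := fun r => x r.toNNReal)
    (hx.comp continuous_real_toNNReal) c t.coe_nonneg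
  simp only [Real.toNNReal_zero, hx0, mul_zero, sub_zero] at h
  simp_rw [itoSum_extend]
  exact h

/-- The Riemann–Itô sums converge to `I` in `L²` and to `pathConv` along almost every path; an
almost surely convergent subsequence identifies the limits. -/
lemma IsWienerIntegral.ae_eq_pathConv {w : ℝ≥0 → Ω → ℝ}
    (hw : IsBrownianReal w P) {c : ℝ} {t : ℝ≥0} {I : Ω → ℝ}
    (hI : IsWienerIntegral P w (fun r => Real.exp (-((t : ℝ) - r) * c)) t I) :
    ∀ᵐ ω ∂P, I ω = pathConv c (fun s => w s ω) t := by
  have hmeas : ∀ n, AEStronglyMeasurable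
      (fun ω => itoSum (fun r => Real.exp (-((t : ℝ) - r) * c)) t n fun s => w s ω) P := by
    intro n
    refine (Finset.aemeasurable_fun_sum _ fun k _ => ?_).aestronglyMeasurable
    exact ((hw.aemeasurable _).sub (hw.aemeasurable _)).const_mul _
  obtain ⟨ns, hns, hlim⟩ := (tendstoInMeasure_of_tendsto_eLpNorm (p := 2)
    (f := fun n ω => itoSum (fun r => Real.exp (-((t : ℝ) - r) * c)) t n fun s => w s ω)
    (by norm_num) hmeas hI.1.1 (by
      refine hI.2.congr fun n => ?_
      rw [← eLpNorm_neg]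
      congr 1
      ext ω
      simp [itoSum])).exists_seq_tendsto_ae
  filter_upwards [hlim, hw.cont, hw.eval_zero_ae_eq_zero] with ω h1 h2 h3
  exact tendsto_nhds_unique h1 ((tendsto_itoSum_pathConv h2 h3 c t).comp hns.tendsto_atTop)

end Brownian

section Continuity

lemma continuous_integral_exp_mul (c : ℝ) {g : ℝ → ℝ} (hg : Continuous g) :
    Continuous fun t : ℝ => ∫ r in (0 : ℝ)..t, Real.exp (-(t - r) * c) * g r := by
  have h : ∀ t, ∫ r in (0 : ℝ)..t, Real.exp (-(t - r) * c) * g r =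
      Real.exp (-t * c) * ∫ r in (0 : ℝ)..t, Real.exp (r * c) * g r := by
    intro t
    rw [← intervalIntegral.integral_const_mul]
    congr 1
    ext r
    rw [← mul_assoc, ← Real.exp_add]
    ring_nf
  simp_rw [h]
  have h2 : Continuous fun r => Real.exp (r * c) * g r := by fun_prop
  exact (by fun_prop : Continuous fun t : ℝ => Real.exp (-t * c)).mul
    (intervalIntegral.continuous_primitive (fun a b => h2.intervalIntegrable a b) 0)

end Continuity

/-! ### Coordinates of the mild solution -/

section Mild

variable {H : Type*} [NormedAddCommGroup H] [InnerProductSpace ℝ H]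
  {e : HilbertBasis ℕ ℝ H}

lemma inner_semigroup (e : HilbertBasis ℕ ℝ H) {lam : ℕ → ℝ} (hlam : ∀ p, 0 ≤ lam p) {t : ℝ}
    (ht : 0 ≤ t) (x : H) (p : ℕ) :
    ⟪e p, semigroup e lam t x⟫ = Real.exp (-t * lam p) * ⟪e p, x⟫ :=
  inner_spectralOp e (C := 1) (fun p => by
    rw [abs_of_pos (Real.exp_pos _), Real.exp_le_one_iff]
    nlinarith [mul_nonneg ht (hlam p)]) x p

/-- This allows the inner product with `e p` to pass inside the Bochner integral. Contractivity
gives the bound, and the partial sums of the spectral series give measurability. -/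
lemma intervalIntegrable_semigroup (e : HilbertBasis ℕ ℝ H) {lam : ℕ → ℝ} (hlam : ∀ p, 0 ≤ lam p)
    {t : ℝ} (ht : 0 ≤ t) {v : ℝ → H} (hv : Continuous v) :
    IntervalIntegrable (fun r => semigroup e lam (t - r) (v r)) volume 0 t := by
  rw [intervalIntegrable_iff_integrableOn_Ioc_of_le ht]
  have hbd : ∀ r ≤ t, ∀ p, |Real.exp (-(t - r) * lam p)| ≤ 1 := fun r hr p => by
    rw [abs_of_pos (Real.exp_pos _), Real.exp_le_one_iff]
    nlinarith [mul_nonneg (sub_nonneg.2 hr) (hlam p)]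
  have hb : IntegrableOn (fun r => ‖v r‖) (Set.Ioc 0 t) :=
    (hv.norm.integrableOn_Icc).mono_set Set.Ioc_subset_Icc_self
  refine hb.mono' ?_ ?_
  · refine aestronglyMeasurable_of_tendsto_ae atTop (f := fun (N : ℕ) r =>
      ∑ p ∈ Finset.range N, (Real.exp (-(t - r) * lam p) * ⟪e p, v r⟫) • e p) (fun N => ?_) ?_
    · exact (by fun_prop : Continuous fun r => ∑ p ∈ Finset.range N,
        (Real.exp (-(t - r) * lam p) * ⟪e p, v r⟫) • e p).aestronglyMeasurable
    · refine (ae_restrict_iff' measurableSet_Ioc).2 (.of_forall fun r hr => ?_)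
      obtain ⟨y, hy, -⟩ := hasSum_diag e (hbd r hr.2) (v r)
      have : semigroup e lam (t - r) (v r) = y := hy.tsum_eq
      rw [this]
      exact hy.tendsto_sum_nat
  · refine (ae_restrict_iff' measurableSet_Ioc).2 (.of_forall fun r hr => ?_)
    have := norm_le_of_inner_diag (hbd r hr.2) (inner_tsum_diag e (hbd r hr.2) (v r))
    rwa [one_mul] at this

lemma inner_of_apply_basis {B : H →L[ℝ] H} {b : ℕ → ℝ} (hB : ∀ p, B (e p) = -(b p • e p)) (x : H)
    (p : ℕ) : ⟪e p, B x⟫ = -b p * ⟪e p, x⟫ := by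
  have h1 := (e.hasSum_repr x).mapL B |>.mapL (innerSL ℝ (e p))
  have h2 : ∀ k, innerSL ℝ (e p) (B (e.repr x k • e k)) = if k = p then -b p * ⟪e p, x⟫ else 0 := by
    intro k
    rw [map_smul, hB, innerSL_apply_apply, e.repr_apply_apply, inner_smul_right, inner_neg_right,
      inner_smul_right]
    split_ifs with h
    · subst h
      rw [real_inner_self_eq_norm_sq, e.orthonormal.norm_eq_one]; ring
    · rw [e.orthonormal.inner_eq_zero (Ne.symm h)]; ring
  simp_rw [h2] at h1
  exact h1.unique (hasSum_ite_eq p _)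

variable {Ω : Type*} [MeasurableSpace Ω] {P : Measure Ω}

lemma IsStochConv.inner_ae_eq {lam q : ℕ → ℝ} {β : ℕ → ℝ≥0 → Ω → ℝ} (hβ : IsWienerFamily P β)
    {t : ℝ≥0} {Z : Ω → H} (hZ : IsStochConv P e lam q β t Z) (p : ℕ) :
    ∀ᵐ ω ∂P, ⟪e p, Z ω⟫ = √(q p) * pathConv (lam p) (fun s => β p s ω) t := by
  obtain ⟨I, hI, hsum⟩ := hZ
  obtain ⟨ns, hns, hlim⟩ := hsum.exists_seq_tendsto_ae fun p =>
    ((hI p).1.1.const_mul _).smul_const _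
  filter_upwards [hlim, (hI p).ae_eq_pathConv (hβ.2.1 p)] with ω h1 h2
  rw [← h2]
  have h3 := (tendsto_const_nhds (x := e p)).inner h1 (𝕜 := ℝ)
  refine tendsto_nhds_unique h3 (tendsto_const_nhds.congr' ?_)
  filter_upwards [hns.tendsto_atTop.eventually_gt_atTop p] with k hk
  rw [inner_sum, Finset.sum_eq_single p]
  · rw [inner_smul_right, real_inner_self_eq_norm_sq, e.orthonormal.norm_eq_one]; ring
  · intro j _ hj
    rw [inner_smul_right, e.orthonormal.inner_eq_zero (Ne.symm hj), mul_zero]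
  · intro h
    exact absurd (Finset.mem_range.2 hk) h

variable [CompleteSpace H] [MeasurableSpace H]

/-- The coordinates of the mild solution are Ornstein–Uhlenbeck processes. -/
lemma IsMildSolution.inner_ae_eq {lam q b : ℕ → ℝ} (hlam : ∀ p, 0 ≤ lam p)
    {β : ℕ → ℝ≥0 → Ω → ℝ} (hβ : IsWienerFamily P β) {B : H →L[ℝ] H}
    (hB : ∀ p, B (e p) = -(b p • e p)) {σ : ℝ} {x : H} {u : ℝ≥0 → Ω → H}
    (hu : IsMildSolution P e lam q β B σ x u) (p : ℕ) :
    ∀ᵐ ω ∂P, ∀ t : ℝ≥0, ⟪e p, u t ω⟫ = Real.exp (-t * (lam p + b p)) * ⟪e p, x⟫ +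
      σ * √(q p) * pathConv (lam p + b p) (fun s => β p s ω) t := by
  obtain ⟨hum, huc, hmild⟩ := hu
  have h1 : ∀ t : ℝ≥0, ∀ᵐ ω ∂P, ⟪e p, u t ω⟫ = Real.exp (-t * lam p) * ⟪e p, x⟫
      - b p * (∫ r in (0 : ℝ)..t, Real.exp (-(t - r) * lam p) * ⟪e p, u r.toNNReal ω⟫)
      + σ * √(q p) * pathConv (lam p) (fun s => β p s ω) t := by
    intro t
    obtain ⟨Z, hZ, hZu⟩ := hmild t
    filter_upwards [hZu, hZ.inner_ae_eq hβ p, huc] with ω h1 h2 h3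
    have hBu : Continuous fun r : ℝ => B (u r.toNNReal ω) :=
      B.continuous.comp (h3.comp continuous_real_toNNReal)
    have h4 := (innerSL ℝ (e p)).intervalIntegral_comp_comm
      (intervalIntegrable_semigroup e hlam t.coe_nonneg hBu)
    simp only [innerSL_apply_apply] at h4
    rw [h1, inner_add_right, inner_add_right, inner_smul_right, h2, inner_semigroup e hlam t.coe_nonneg]
    have h5 : ⟪e p, ∫ r in (0 : ℝ)..t, semigroup e lam (t - r) (B (u r.toNNReal ω))⟫ =
        - (b p * ∫ r in (0 : ℝ)..t, Real.exp (-(t - r) * lam p) * ⟪e p, u r.toNNReal ω⟫) := by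
      refine h4.symm.trans ?_
      rw [← intervalIntegral.integral_const_mul, ← intervalIntegral.integral_neg]
      refine intervalIntegral.integral_congr fun r hr => ?_
      rw [Set.uIcc_of_le t.coe_nonneg] at hr
      rw [inner_semigroup e hlam (sub_nonneg.2 hr.2), inner_of_apply_basis hB]
      ring
    rw [h5]
    ring
  -- The null set of the mild equation depends on `t`. Countably many dense times share one null
  -- set, and continuity of both sides in `t` gives the remaining times.
  have h2 : ∀ᵐ ω ∂P, ∀ s : ℕ, ⟪e p, u (TopologicalSpace.denseSeq ℝ≥0 s) ω⟫ = _ :=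
    ae_all_iff.2 fun s => h1 (TopologicalSpace.denseSeq ℝ≥0 s)
  filter_upwards [h2, huc, (hβ.2.1 p).cont] with ω h2 h3 h4
  have hyc : Continuous fun r : ℝ => ⟪e p, u r.toNNReal ω⟫ :=
    continuous_const.inner (h3.comp continuous_real_toNNReal)
  have hwc : Continuous fun r : ℝ => β p r.toNNReal ω := h4.comp continuous_real_toNNReal
  have hpc : ∀ c, Continuous fun r : ℝ => pathConv c (fun s => β p s ω) r := fun c =>
    hwc.sub (continuous_const.mul (continuous_integral_exp_mul c hwc))
  have hall : ∀ t : ℝ≥0, ⟪e p, u t ω⟫ = Real.exp (-t * lam p) * ⟪e p, x⟫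
      - b p * (∫ r in (0 : ℝ)..t, Real.exp (-(t - r) * lam p) * ⟪e p, u r.toNNReal ω⟫)
      + σ * √(q p) * pathConv (lam p) (fun s => β p s ω) t := by
    refine congrFun (Continuous.ext_on (TopologicalSpace.denseRange_denseSeq ℝ≥0)
      (f := fun t => ⟪e p, u t ω⟫) (g := fun t : ℝ≥0 => Real.exp (-t * lam p) * ⟪e p, x⟫
      - b p * (∫ r in (0 : ℝ)..t, Real.exp (-(t - r) * lam p) * ⟪e p, u r.toNNReal ω⟫)
      + σ * √(q p) * pathConv (lam p) (fun s => β p s ω) t) ?_ ?_ ?_)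
    · exact continuous_const.inner h3
    · have := (continuous_integral_exp_mul (lam p) hyc).comp NNReal.continuous_coe
      have := (hpc (lam p)).comp NNReal.continuous_coe
      simp only [Function.comp_def] at *
      fun_prop
    · rintro _ ⟨s, rfl⟩
      exact h2 s
  intro t
  have := eq_of_mild_equation hyc hwc (lam := lam p) (b := b p) (x := ⟪e p, x⟫)
    (s := σ * √(q p)) (fun t ht => by
      have := hall t.toNNReal
      rw [Real.coe_toNNReal _ ht] at this
      exact this) t.coe_nonneg
  rw [pathConv]
  simpa only [Real.toNNReal_coe] using this

end Mild

/-! ### Law of the mild solution at a fixed time -/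

section MildLaw

variable {Ω : Type*} [MeasurableSpace Ω] {P : Measure Ω}

lemma tendsto_sum_exp_sq {c : ℝ} (hc : 0 < c) (t : ℝ≥0) :
    Tendsto (fun n : ℕ => ∑ k ∈ Finset.range n,
      Real.exp (-((t : ℝ) - (k : ℝ) * t / n) * c) ^ 2 * (t / n)) atTop
      (𝓝 ((1 - Real.exp (-t * c) ^ 2) / (2 * c))) := by
  have hg : Continuous fun r : ℝ => Real.exp (-((t : ℝ) - r) * c) ^ 2 := by fun_prop
  have h := tendsto_riemann_sum hg (continuous_const (y := (1 : ℝ))) t.coe_nonneg (θ := 0)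
    ⟨le_rfl, zero_le_one⟩
  have hd : ∀ r : ℝ, HasDerivAt (fun r : ℝ => Real.exp (-((t : ℝ) - r) * c) ^ 2 / (2 * c))
      (Real.exp (-((t : ℝ) - r) * c) ^ 2) r := fun r => by
    have h1 : HasDerivAt (fun r : ℝ => -((t : ℝ) - r) * c) c r := by
      simpa using (((hasDerivAt_id r).const_sub (t : ℝ)).neg.mul_const c)
    refine (((h1.exp).pow 2).div_const (2 * c)).congr_deriv ?_
    field_simp
    simp
    ring
  have hI : ∫ r in (0 : ℝ)..t, Real.exp (-((t : ℝ) - r) * c) ^ 2 * 1 =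
      (1 - Real.exp (-t * c) ^ 2) / (2 * c) := by
    simp only [mul_one]
    rw [intervalIntegral.integral_eq_sub_of_hasDerivAt (fun r _ => hd r)
      (hg.intervalIntegrable _ _)]
    simp only [sub_self, neg_zero, zero_mul, Real.exp_zero, sub_zero]
    ring
  rw [hI] at h
  refine h.congr fun n => Finset.sum_congr rfl fun k _ => ?_
  simp only [intervalIntegral.integral_const, smul_eq_mul, mul_one, add_zero]
  ring

/-- Joint Fourier transform of finitely many scalar stochastic convolutions. -/
lemma integral_cexp_pathConv [IsProbabilityMeasure P] {β : ℕ → ℝ≥0 → Ω → ℝ}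
    (hβ : IsWienerFamily P β) {c : ℕ → ℝ} (hc : ∀ p, 0 < c p) (t : ℝ≥0) (N : ℕ) (θ : ℕ → ℝ) :
    ∫ ω, Complex.exp ((∑ p ∈ Finset.range N, θ p * pathConv (c p) (fun s => β p s ω) t : ℝ) *
      Complex.I) ∂P =
    (Real.exp (-(∑ p ∈ Finset.range N,
      θ p ^ 2 * ((1 - Real.exp (-t * c p) ^ 2) / (2 * c p))) / 2) : ℝ) := by
  have hpath : ∀ p, Measurable fun ω s => β p s ω := fun p =>
    measurable_pi_iff.2 fun s => hβ.1 p s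
  set f : ℕ → ℝ → ℝ := fun p r => Real.exp (-((t : ℝ) - r) * c p)
  have hmeas : ∀ n p, Measurable fun ω => itoSum (f p) t n fun s => β p s ω := fun n p =>
    (measurable_itoSum _ _ _).comp (hpath p)
  -- Independence is applied to the Riemann–Itô sums, which are measurable on path space; `pathConv`
  -- enters only as their almost sure limit.
  have hind : ∀ n, iIndepFun (fun p ω => itoSum (f p) t n fun s => β p s ω) P := fun n =>
    hβ.2.2.comp (fun p => itoSum (f p) t n) fun p => measurable_itoSum _ _ _
  have h1 := tendsto_integral_cexp_of_ae (P := P)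
    (X := fun n ω => ∑ p ∈ Finset.range N, θ p * itoSum (f p) t n fun s => β p s ω)
    (Y := fun ω => ∑ p ∈ Finset.range N, θ p * pathConv (c p) (fun s => β p s ω) t)
    (fun n => (Finset.measurable_fun_sum _ fun p _ => (hmeas n p).const_mul _).aemeasurable) (by
      have h2 : ∀ᵐ ω ∂P, ∀ p, Continuous fun s => β p s ω := ae_all_iff.2 fun p => (hβ.2.1 p).cont
      have h3 : ∀ᵐ ω ∂P, ∀ p, β p 0 ω = 0 := ae_all_iff.2 fun p => (hβ.2.1 p).eval_zero_ae_eq_zero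
      filter_upwards [h2, h3] with ω h2 h3
      exact tendsto_finsetSum _ fun p _ =>
        (tendsto_itoSum_pathConv (h2 p) (h3 p) (c p) t).const_mul _)
  refine tendsto_nhds_unique h1 ?_
  simp_rw [fun n => integral_cexp_sum_of_iIndepFun (fun p => (hmeas n p).aemeasurable) (hind n) N θ,
    fun n p => charFun_itoSum (hβ.2.1 p).toIsPreBrownianReal (f p) t n (θ p),
    ← Complex.ofReal_prod, ← Real.exp_sum]
  refine (Complex.continuous_ofReal.tendsto _).comp ((Real.continuous_exp.tendsto _).comp ?_)
  rw [← Finset.sum_neg_distrib, Finset.sum_div]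
  exact tendsto_finsetSum _ fun p _ => (((tendsto_sum_exp_sq (hc p) t).const_mul _).neg).div_const _

variable {H : Type*} [NormedAddCommGroup H] [InnerProductSpace ℝ H] [CompleteSpace H]
  [MeasurableSpace H] [BorelSpace H] [SecondCountableTopology H] {e : HilbertBasis ℕ ℝ H}

/-- The stationary variances of the modes of the SPDE. -/
noncomputable def spdeVar (lam q b : ℕ → ℝ) (σ : ℝ) (p : ℕ) : ℝ :=
  σ ^ 2 * q p / (2 * (lam p + b p))

lemma IsMildSolution.charFun_map [IsProbabilityMeasure P] {lam q b : ℕ → ℝ}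
    (hlam : ∀ p, 0 ≤ lam p) (hq : ∀ p, 0 ≤ q p) (hc : ∀ p, 0 < lam p + b p) {σ : ℝ}
    (hv : Summable (spdeVar lam q b σ)) {β : ℕ → ℝ≥0 → Ω → ℝ} (hβ : IsWienerFamily P β)
    {B : H →L[ℝ] H} (hB : ∀ p, B (e p) = -(b p • e p)) {x : H} {u : ℝ≥0 → Ω → H}
    (hu : IsMildSolution P e lam q β B σ x u) (t : ℝ≥0) {S : H →L[ℝ] H}
    (hS : ∀ x p, ⟪e p, S x⟫ = Real.exp (-t * (lam p + b p)) * ⟪e p, x⟫) (ξ : H) :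
    charFun (P.map (u t)) ξ = Complex.exp ((⟪x, S ξ⟫ : ℝ) * Complex.I) *
      (Real.exp (-(∑' p, (1 - Real.exp (-t * (lam p + b p)) ^ 2) * spdeVar lam q b σ p *
        ⟪e p, ξ⟫ ^ 2) / 2) : ℝ) := by
  have hum := hu.1
  have hcoord : ∀ᵐ ω ∂P, ∀ p, ⟪e p, u t ω⟫ = Real.exp (-t * (lam p + b p)) * ⟪e p, x⟫ +
      σ * √(q p) * pathConv (lam p + b p) (fun s => β p s ω) t := by
    refine ae_all_iff.2 fun p => ?_
    filter_upwards [hu.inner_ae_eq hlam hβ hB p] with ω hω using hω t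
  rw [charFun_apply, integral_map (hum t).aemeasurable (by fun_prop)]
  have h1 := tendsto_integral_cexp_of_ae (P := P)
    (X := fun N ω => ∑ p ∈ Finset.range N, ⟪e p, u t ω⟫ * ⟪e p, ξ⟫)
    (Y := fun ω => ⟪u t ω, ξ⟫) (fun N => by
      refine (Finset.measurable_fun_sum _ fun p _ => Measurable.mul_const ?_ _).aemeasurable
      exact (by fun_prop : Measurable fun y : H => ⟪e p, y⟫).comp (hum t))
    (.of_forall fun ω => by
      refine (e.hasSum_inner_mul_inner (u t ω) ξ).tendsto_sum_nat.congr fun N => ?_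
      exact Finset.sum_congr rfl fun p _ => by rw [real_inner_comm])
  refine tendsto_nhds_unique h1 ?_
  have h2 : ∀ N, ∫ ω, Complex.exp ((∑ p ∈ Finset.range N, ⟪e p, u t ω⟫ * ⟪e p, ξ⟫ : ℝ) *
      Complex.I) ∂P = Complex.exp ((∑ p ∈ Finset.range N, ⟪x, e p⟫ * ⟪e p, S ξ⟫ : ℝ) * Complex.I) *
      (Real.exp (-(∑ p ∈ Finset.range N, (1 - Real.exp (-t * (lam p + b p)) ^ 2) *
        spdeVar lam q b σ p * ⟪e p, ξ⟫ ^ 2) / 2) : ℝ) := by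
    intro N
    have h3 := integral_cexp_pathConv hβ hc t N fun p => σ * √(q p) * ⟪e p, ξ⟫
    have h4 : ∑ p ∈ Finset.range N, (1 - Real.exp (-t * (lam p + b p)) ^ 2) *
        spdeVar lam q b σ p * ⟪e p, ξ⟫ ^ 2 = ∑ p ∈ Finset.range N, (σ * √(q p) * ⟪e p, ξ⟫) ^ 2 *
          ((1 - Real.exp (-t * (lam p + b p)) ^ 2) / (2 * (lam p + b p))) := by
      refine Finset.sum_congr rfl fun p _ => ?_
      rw [mul_pow, mul_pow, Real.sq_sqrt (hq p), spdeVar]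
      ring
    rw [h4, ← h3, ← integral_const_mul]
    refine integral_congr_ae ?_
    filter_upwards [hcoord] with ω hω
    rw [← Complex.exp_add, ← add_mul, ← Complex.ofReal_add, ← Finset.sum_add_distrib]
    congr 3
    refine Finset.sum_congr rfl fun p _ => ?_
    rw [hω, hS, real_inner_comm (e p) x]
    ring
  simp_rw [h2]
  refine Tendsto.mul ?_ ?_
  · refine (Complex.continuous_exp.tendsto _).comp (Tendsto.mul_const _ ?_)
    exact (Complex.continuous_ofReal.tendsto _).comp
      (e.hasSum_inner_mul_inner x (S ξ)).tendsto_sum_nat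
  · refine (Complex.continuous_ofReal.tendsto _).comp ((Real.continuous_exp.tendsto _).comp ?_)
    obtain ⟨C, hC⟩ := exists_abs_le_of_summable hv
    have hs := summable_mul_inner_sq (C := 1 * C)
      (v := fun p => (1 - Real.exp (-t * (lam p + b p)) ^ 2) * spdeVar lam q b σ p) e (fun p => by
        have h0 := Real.exp_pos (-t * (lam p + b p))
        have h1 : Real.exp (-t * (lam p + b p)) ≤ 1 := by
          rw [Real.exp_le_one_iff]
          nlinarith [mul_nonneg t.coe_nonneg (hc p).le]
        rw [abs_mul]
        refine mul_le_mul ?_ (hC p) (abs_nonneg _) zero_le_one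
        rw [abs_le]; constructor <;> nlinarith) ξ
    exact (hs.hasSum.tendsto_sum_nat.neg).div_const 2

end MildLaw

/-! ### Comparison of the stationary variances -/

section Variance

lemma theta_mem : 0 < theta ∧ theta ≤ 1 := by
  have h1 : (1 : ℝ) ≤ √2 := by rw [Real.one_le_sqrt]; norm_num
  have h2 : √2 < 2 := by rw [Real.sqrt_lt' (by norm_num)]; norm_num
  unfold theta
  constructor <;> linarith

/-- With `x = hλ` and `y = hb` this is the relative error of the postprocessed variance. It vanishes
when `x = 0` or `y = 0`; `hid` extracts the factor `x y`, and the bracket that remains is at most 5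
+ 3. Every `θ` in `[0, 1]` is admissible. -/
lemma abs_variance_defect_le {θ x y : ℝ} (hθ0 : 0 ≤ θ) (hθ1 : θ ≤ 1) (hx : 0 ≤ x) (hy : |y| ≤ 1) :
    |1 - 2 * (1 - y / (2 * (1 + θ * x))) ^ 2 / (2 + x - y) - (x + y) / (2 + x)| ≤
      8 * |y| * (x / (1 + x)) := by
  have hD : 1 ≤ 1 + θ * x := by nlinarith [mul_nonneg hθ0 hx]
  have hy' := abs_le.1 hy
  have hE : 0 < 2 + x - y := by linarith
  have hid : 1 - 2 * (1 - y / (2 * (1 + θ * x))) ^ 2 / (2 + x - y) - (x + y) / (2 + x) =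
      y * (x * ((1 - 4 * θ - θ * x) / (1 + θ * x) +
        y * ((4 * θ + 2 * θ ^ 2 * x - 1) / (2 * (1 + θ * x) ^ 2))) / ((2 + x) * (2 + x - y))) := by
    have hD' : 1 + θ * x ≠ 0 := by positivity
    have hE' : 2 + x - y ≠ 0 := hE.ne'
    have hF' : 2 + x ≠ 0 := by positivity
    field_simp
    ring
  have hθx := mul_nonneg hθ0 hx
  have h1 : |(1 - 4 * θ - θ * x) / (1 + θ * x)| ≤ 5 := by
    rw [abs_div, abs_of_pos (show 0 < 1 + θ * x by positivity), div_le_iff₀ (by positivity), abs_le]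
    constructor <;> linarith
  have h2 : |(4 * θ + 2 * θ ^ 2 * x - 1) / (2 * (1 + θ * x) ^ 2)| ≤ 3 := by
    rw [abs_div, abs_of_pos (show 0 < 2 * (1 + θ * x) ^ 2 by positivity),
      div_le_iff₀ (by positivity), abs_le]
    have : θ ^ 2 * x ≤ θ * x := by nlinarith
    have : 0 ≤ θ ^ 2 * x := by positivity
    constructor <;> nlinarith
  have h3 : |(1 - 4 * θ - θ * x) / (1 + θ * x) +
        y * ((4 * θ + 2 * θ ^ 2 * x - 1) / (2 * (1 + θ * x) ^ 2))| ≤ 8 := by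
    refine (abs_add_le ((1 - 4 * θ - θ * x) / (1 + θ * x)) _).trans ?_
    rw [abs_mul]
    nlinarith [mul_le_mul hy h2 (abs_nonneg _) zero_le_one]
  rw [hid, abs_mul, abs_div, abs_mul, abs_of_nonneg hx,
    abs_of_pos (show 0 < (2 + x) * (2 + x - y) by positivity), mul_comm 8 |y|, mul_assoc |y| 8]
  refine mul_le_mul_of_nonneg_left ?_ (abs_nonneg y)
  rw [← mul_div_assoc 8 x, div_le_div_iff₀ (by positivity) (by positivity)]
  have h4 : x * |(1 - 4 * θ - θ * x) / (1 + θ * x) +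
        y * ((4 * θ + 2 * θ ^ 2 * x - 1) / (2 * (1 + θ * x) ^ 2))| ≤ 8 * x := by
    nlinarith
  refine mul_le_mul h4 ?_ (by positivity) (by positivity)
  nlinarith

/-- Interpolation between the bounds `x` and 1. It is what converts regularity of the noise into
extra powers of `h`. -/
lemma div_one_add_le_rpow {x s : ℝ} (hx : 0 < x) (hs0 : 0 ≤ s) (hs1 : s ≤ 1) :
    x / (1 + x) ≤ x ^ s := by
  rcases le_total x 1 with h | h
  · calc x / (1 + x) ≤ x := div_le_self hx.le (by linarith)
      _ = x ^ (1 : ℝ) := (Real.rpow_one x).symm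
      _ ≤ x ^ s := Real.rpow_le_rpow_of_exponent_ge hx h hs1
  · calc x / (1 + x) ≤ 1 := by rw [div_le_one (by positivity)]; linarith
      _ ≤ x ^ s := Real.one_le_rpow h hs0

/-- The stationary variances of the modes of the integrator. -/
noncomputable def schemeVar (lam q b : ℕ → ℝ) (σ h : ℝ) (p : ℕ) : ℝ :=
  σ ^ 2 * q p * (1 - h * b p / (2 * (1 + theta * (h * lam p)))) ^ 2 /
    ((lam p + b p) * (2 + h * lam p - h * b p))

/-- The stationary variances of the modes of the postprocessed integrator. -/
noncomputable def postVar (lam q b : ℕ → ℝ) (σ h : ℝ) (p : ℕ) : ℝ :=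
  schemeVar lam q b σ h p + σ ^ 2 * h / 4 * ((1 + h / 2 * lam p)⁻¹ * q p)

variable {lam q b : ℕ → ℝ}

/-- Since `lam p ^ (-s)` is largest at `p = 0`, the trace of `(-A)⁻¹ Q` is finite too; this is what
makes all the variances summable. -/
lemma summable_of_exponent_le {s : ℝ} (hl0 : 0 < lam 0) (hmono : Monotone lam)
    (hq : ∀ p, 0 ≤ q p) (hs : 0 ≤ s) (hsum : Summable fun p => lam p ^ (-1 + s) * q p) :
    Summable fun p => q p / lam p := by
  have hl : ∀ p, 0 < lam p := fun p => hl0.trans_le (hmono (Nat.zero_le p))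
  refine Summable.of_nonneg_of_le (fun p => div_nonneg (hq p) (hl p).le) (fun p => ?_)
    (hsum.mul_left (lam 0 ^ (-s)))
  have h1 : lam p ^ (-s) ≤ lam 0 ^ (-s) :=
    Real.rpow_le_rpow_of_nonpos hl0 (hmono (Nat.zero_le p)) (by linarith)
  have h2 : q p / lam p = lam p ^ (-s) * (lam p ^ (-1 + s) * q p) := by
    rw [← mul_assoc, ← Real.rpow_add (hl p), show -s + (-1 + s) = -1 by ring,
      Real.rpow_neg_one]
    ring
  rw [h2]
  exact mul_le_mul_of_nonneg_right h1 (mul_nonneg (Real.rpow_nonneg (hl p).le _) (hq p))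

lemma exists_exponent {s : ℝ} (hsB : 0 < sBar lam q) (hs : s < sBar lam q) :
    ∃ s', s < s' ∧ 0 < s' ∧ s' < 1 ∧ Summable fun p => lam p ^ (-1 + s') * q p := by
  have hne : {s : ℝ | 0 < s ∧ s < 1 ∧ Summable (fun p => lam p ^ (-1 + s) * q p)}.Nonempty := by
    by_contra hemp
    rw [Set.not_nonempty_iff_eq_empty] at hemp
    rw [sBar, hemp, Real.sSup_empty] at hsB
    exact lt_irrefl _ hsB
  obtain ⟨s', ⟨h1, h2, h3⟩, h4⟩ := exists_lt_of_lt_csSup hne hs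
  exact ⟨s', h4, h1, h2, h3⟩

/-- Once `lam p ≥ 2 * lam 0`, the ratio `lam p / (lam p + b p)` is at most 2, and only finitely many
ratios remain. Hence `|b p|` may come arbitrarily close to `lam 0`. -/
lemma exists_div_add_le (hl0 : 0 < lam 0) (hmono : Monotone lam)
    (htop : Tendsto lam atTop atTop) (hb : ∀ p, |b p| < lam 0) :
    ∃ K, 0 < K ∧ ∀ p, (lam p + b p)⁻¹ ≤ K / lam p := by
  have hl : ∀ p, 0 < lam p := fun p => hl0.trans_le (hmono (Nat.zero_le p))
  have hc : ∀ p, 0 < lam p + b p := fun p => by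
    linarith [(abs_lt.1 (hb p)).1, hmono (Nat.zero_le p)]
  have hbd : IsBoundedUnder (· ≤ ·) atTop fun p => lam p / (lam p + b p) := by
    refine ⟨2, ?_⟩
    rw [eventually_map]
    filter_upwards [htop.eventually_ge_atTop (2 * lam 0)] with p hp
    rw [div_le_iff₀ (hc p)]
    linarith [(abs_lt.1 (hb p)).1]
  obtain ⟨K, hK⟩ := hbd.bddAbove_range
  have hK' : ∀ p, lam p / (lam p + b p) ≤ K := fun p => hK ⟨p, rfl⟩
  refine ⟨K, (div_pos (hl 0) (hc 0)).trans_le (hK' 0), fun p => ?_⟩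
  rw [le_div_iff₀ (hl p), mul_comm]
  exact hK' p

lemma spdeVar_nonneg (hq : ∀ p, 0 ≤ q p) (hc : ∀ p, 0 < lam p + b p) (σ : ℝ) (p : ℕ) :
    0 ≤ spdeVar lam q b σ p :=
  div_nonneg (mul_nonneg (sq_nonneg _) (hq p)) (by linarith [hc p])

lemma spdeVar_le {K : ℝ} (hq : ∀ p, 0 ≤ q p)
    (hK : ∀ p, (lam p + b p)⁻¹ ≤ K / lam p) (σ : ℝ) (p : ℕ) :
    spdeVar lam q b σ p ≤ σ ^ 2 / 2 * (K * (q p / lam p)) := by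
  have h1 : spdeVar lam q b σ p = σ ^ 2 / 2 * q p * (lam p + b p)⁻¹ := by
    rw [spdeVar, div_eq_mul_inv, mul_inv]; ring
  rw [h1]
  refine (mul_le_mul_of_nonneg_left (hK p) (mul_nonneg (by positivity) (hq p))).trans_eq ?_
  ring

lemma summable_spdeVar {K : ℝ} (hq : ∀ p, 0 ≤ q p) (hc : ∀ p, 0 < lam p + b p)
    (hK : ∀ p, (lam p + b p)⁻¹ ≤ K / lam p) (hs : Summable fun p => q p / lam p) (σ : ℝ) :
    Summable (spdeVar lam q b σ) :=
  Summable.of_nonneg_of_le (spdeVar_nonneg hq hc σ) (spdeVar_le hq hK σ)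
    ((hs.mul_left K).mul_left _)

section Scheme

variable {σ h : ℝ}

lemma schemeVar_nonneg (hq : ∀ p, 0 ≤ q p) (hl : ∀ p, 0 < lam p) (hc : ∀ p, 0 < lam p + b p)
    (hh : 0 < h) (hhb : ∀ p, |h * b p| ≤ 1) (p : ℕ) : 0 ≤ schemeVar lam q b σ h p := by
  have h1 := (abs_le.1 (hhb p)).2
  have h2 := mul_pos hh (hl p)
  exact div_nonneg (mul_nonneg (mul_nonneg (sq_nonneg _) (hq p)) (sq_nonneg _))
    (mul_nonneg (hc p).le (by linarith))

/-- The ratio of the variances is `2 g² / (2 + hλ - hb)` with `g² ≤ 4` and denominator at least 1,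
whence the 8. -/
lemma schemeVar_le (hq : ∀ p, 0 ≤ q p) (hl : ∀ p, 0 < lam p) (hc : ∀ p, 0 < lam p + b p)
    (hh : 0 < h) (hhb : ∀ p, |h * b p| ≤ 1) (p : ℕ) :
    schemeVar lam q b σ h p ≤ 8 * spdeVar lam q b σ p := by
  have h1 := abs_le.1 (hhb p)
  have h2 := mul_pos hh (hl p)
  have h3 : 0 < 2 * (1 + theta * (h * lam p)) := by
    have := theta_mem.1
    positivity
  have hg : |h * b p / (2 * (1 + theta * (h * lam p)))| ≤ 1 := by
    rw [abs_div, abs_of_pos h3, div_le_one h3]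
    nlinarith [hhb p, mul_pos theta_mem.1 h2]
  have hg2 : (1 - h * b p / (2 * (1 + theta * (h * lam p)))) ^ 2 ≤ 4 := by
    have := abs_le.1 hg
    nlinarith
  have hA := mul_nonneg (sq_nonneg σ) (hq p)
  have hcp := hc p
  rw [schemeVar, spdeVar, ← mul_div_assoc, div_le_div_iff₀ (mul_pos hcp (by linarith)) (by linarith)]
  calc σ ^ 2 * q p * (1 - h * b p / (2 * (1 + theta * (h * lam p)))) ^ 2 * (2 * (lam p + b p))
      ≤ σ ^ 2 * q p * 4 * (2 * (lam p + b p)) := by gcongr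
    _ = 8 * (σ ^ 2 * q p) * ((lam p + b p) * 1) := by ring
    _ ≤ 8 * (σ ^ 2 * q p) * ((lam p + b p) * (2 + h * lam p - h * b p)) := by
      gcongr; linarith

lemma postprocVar_le (hq : ∀ p, 0 ≤ q p) (hl : ∀ p, 0 < lam p) (hh : 0 < h) (p : ℕ) :
    (1 + h / 2 * lam p)⁻¹ * q p ≤ 2 / h * (q p / lam p) := by
  have := hl p
  rw [div_mul_div_comm, ← div_eq_inv_mul, div_le_div_iff₀ (by positivity) (by positivity)]
  nlinarith [hq p, mul_nonneg (hq p) (mul_pos hh (hl p)).le]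

lemma summable_postprocVar (hq : ∀ p, 0 ≤ q p) (hl : ∀ p, 0 < lam p) (hh : 0 < h)
    (hs : Summable fun p => q p / lam p) : Summable fun p => (1 + h / 2 * lam p)⁻¹ * q p :=
  Summable.of_nonneg_of_le (fun p => by have := hl p; have := hq p; positivity)
    (postprocVar_le hq hl hh) (hs.mul_left _)

lemma spdeVar_sub_postVar (hl : ∀ p, 0 < lam p) (hc : ∀ p, 0 < lam p + b p)
    (hh : 0 < h) (hhb : ∀ p, |h * b p| ≤ 1) (p : ℕ) :
    spdeVar lam q b σ p - postVar lam q b σ h p = spdeVar lam q b σ p *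
      (1 - 2 * (1 - h * b p / (2 * (1 + theta * (h * lam p)))) ^ 2 / (2 + h * lam p - h * b p) -
        (h * lam p + h * b p) / (2 + h * lam p)) := by
  have h1 := abs_le.1 (hhb p)
  have h2 := mul_pos hh (hl p)
  have h3 : 2 + h * lam p - h * b p ≠ 0 := by linarith
  have h4 := (hc p).ne'
  have h5 : 2 + h * lam p ≠ 0 := by linarith
  have h6 : 1 + h / 2 * lam p ≠ 0 := by nlinarith
  rw [postVar, schemeVar, spdeVar]
  set g := (1 - h * b p / (2 * (1 + theta * (h * lam p)))) ^ 2
  have h7 : (1 + h / 2 * lam p)⁻¹ = 2 / (2 + h * lam p) := by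
    rw [inv_eq_one_div, div_eq_div_iff h6 h5]; ring
  rw [h7]
  field_simp
  ring

lemma abs_spdeVar_sub_postVar_le {K L s : ℝ} (hq : ∀ p, 0 ≤ q p) (hl : ∀ p, 0 < lam p)
    (hc : ∀ p, 0 < lam p + b p) (hK : ∀ p, (lam p + b p)⁻¹ ≤ K / lam p) (hb : ∀ p, |b p| ≤ L)
    (hs0 : 0 ≤ s) (hs1 : s ≤ 1) (hh : 0 < h) (hhb : ∀ p, |h * b p| ≤ 1) (p : ℕ) :
    |spdeVar lam q b σ p - postVar lam q b σ h p| ≤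
      4 * K * L * σ ^ 2 * h ^ (1 + s) * (lam p ^ (-1 + s) * q p) := by
  have hx := mul_pos hh (hl p)
  rw [spdeVar_sub_postVar hl hc hh hhb, abs_mul, abs_of_nonneg (spdeVar_nonneg hq hc σ p)]
  have h1 := abs_variance_defect_le theta_mem.1.le theta_mem.2 hx.le (hhb p)
  have h2 := div_one_add_le_rpow hx hs0 hs1
  have h3 : |h * b p| ≤ h * L := by
    rw [abs_mul, abs_of_pos hh]; exact mul_le_mul_of_nonneg_left (hb p) hh.le
  have hL : 0 ≤ h * L := (abs_nonneg _).trans h3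
  have h4 := h1.trans (mul_le_mul (mul_le_mul_of_nonneg_left h3 (by norm_num : (0 : ℝ) ≤ 8)) h2
    (by positivity) (by positivity))
  have h5 := spdeVar_le hq hK σ p
  refine (mul_le_mul h5 h4 (abs_nonneg _) ((spdeVar_nonneg hq hc σ p).trans h5)).trans_eq ?_
  rw [Real.mul_rpow hh.le (hl p).le, Real.rpow_add hh, Real.rpow_one, Real.rpow_add (hl p),
    Real.rpow_neg_one]
  ring

end Scheme

/-- The order of convergence of the variances. -/
lemma exists_variance_bound {L s : ℝ} (hl0 : 0 < lam 0) (hmono : Monotone lam)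
    (htop : Tendsto lam atTop atTop) (hq : ∀ p, 0 ≤ q p) (hb : ∀ p, |b p| < lam 0)
    (hbL : ∀ p, |b p| ≤ L) (hsB : 0 < sBar lam q) (hs : s < sBar lam q) :
    ∃ C, 0 < C ∧ ∀ σ h : ℝ, 0 < h → h * L < 1 →
      ∑' p, |spdeVar lam q b σ p - postVar lam q b σ h p| ≤ C * σ ^ 2 * h ^ (1 + s) := by
  have hl : ∀ p, 0 < lam p := fun p => hl0.trans_le (hmono (Nat.zero_le p))
  have hc : ∀ p, 0 < lam p + b p := fun p => by
    linarith [(abs_lt.1 (hb p)).1, hmono (Nat.zero_le p)]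
  -- The given `s` may be negative, while the interpolation needs an exponent in `[0, 1]` with
  -- finite trace. The estimate is made at `s' > s` and weakened to `s` afterwards.
  obtain ⟨s', hss', hs0, hs1, hsum⟩ := exists_exponent hsB hs
  obtain ⟨K, hK0, hK⟩ := exists_div_add_le hl0 hmono htop hb
  have hL0 : 0 ≤ L := (abs_nonneg _).trans (hbL 0)
  set T := ∑' p, lam p ^ (-1 + s') * q p with hT
  have hT0 : 0 ≤ T := tsum_nonneg fun p => mul_nonneg (Real.rpow_nonneg (hl p).le _) (hq p)
  -- The `+ 1` keeps the constant positive when `L` or `T` vanishes.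
  refine ⟨4 * K * L * (L⁻¹) ^ (s' - s) * T + 1, by positivity, fun σ h hh hhL => ?_⟩
  have hhb : ∀ p, |h * b p| ≤ 1 := fun p => by
    rw [abs_mul, abs_of_pos hh]
    exact (mul_le_mul_of_nonneg_left (hbL p) hh.le).trans hhL.le
  have hterm := abs_spdeVar_sub_postVar_le (σ := σ) hq hl hc hK hbL hs0.le hs1.le hh hhb
  have hdom := hsum.mul_left (4 * K * L * σ ^ 2 * h ^ (1 + s'))
  have h1 := (Summable.of_nonneg_of_le (fun p => abs_nonneg _) hterm hdom).tsum_le_tsum hterm hdom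
  rw [tsum_mul_left, ← hT] at h1
  refine h1.trans ?_
  -- Here `h < 1 / L` bounds `h ^ (s' - s)`. When `L = 0` the step `h` is unbounded, but the
  -- prefactor `L` annihilates both sides.
  have hpow : L * h ^ (1 + s') ≤ L * ((L⁻¹) ^ (s' - s) * h ^ (1 + s)) := by
    rcases hL0.eq_or_lt with h0 | h0
    · simp [← h0]
    · refine mul_le_mul_of_nonneg_left ?_ hL0
      rw [show 1 + s' = (s' - s) + (1 + s) by ring, Real.rpow_add hh]
      refine mul_le_mul_of_nonneg_right ?_ (Real.rpow_nonneg hh.le _)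
      refine Real.rpow_le_rpow hh.le ?_ (by linarith)
      rw [le_inv_comm₀ hh h0, ← one_div, le_div_iff₀ hh, mul_comm]
      exact hhL.le
  have h2 : 0 ≤ σ ^ 2 * h ^ (1 + s) := mul_nonneg (sq_nonneg _) (Real.rpow_nonneg hh.le _)
  calc 4 * K * L * σ ^ 2 * h ^ (1 + s') * T = 4 * K * σ ^ 2 * T * (L * h ^ (1 + s')) := by ring
    _ ≤ 4 * K * σ ^ 2 * T * (L * ((L⁻¹) ^ (s' - s) * h ^ (1 + s))) :=
      mul_le_mul_of_nonneg_left hpow (by positivity)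
    _ ≤ (4 * K * L * (L⁻¹) ^ (s' - s) * T + 1) * σ ^ 2 * h ^ (1 + s) := by
      nlinarith

end Variance

/-! ### Invariant law of the equation -/

lemma exists_kernel_map {X Y Z : Type*} [MeasurableSpace X] [MeasurableSpace Y] [MeasurableSpace Z]
    (γ : Measure Y) [IsProbabilityMeasure γ] {F : X → Y → Z}
    (hF : Measurable fun z : X × Y => F z.1 z.2) :
    ∃ K : Kernel X Z, IsMarkovKernel K ∧ ∀ x, K x = γ.map (F x) := by
  refine ⟨(Kernel.id ×ₖ Kernel.const X γ).map (fun z : X × Y => F z.1 z.2),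
    Kernel.IsMarkovKernel.map _ hF, fun x => ?_⟩
  rw [Kernel.map_apply _ hF, Kernel.prod_apply, Kernel.id_apply, Kernel.const_apply,
    Measure.dirac_prod, Measure.map_map hF measurable_prodMk_left]
  rfl

lemma exists_semigroup_op {H : Type*} [NormedAddCommGroup H] [InnerProductSpace ℝ H]
    (e : HilbertBasis ℕ ℝ H) {c : ℕ → ℝ} (hc : ∀ p, 0 < c p) (t : ℝ≥0) :
    ∃ S : H →L[ℝ] H, ∀ x p, ⟪e p, S x⟫ = Real.exp (-t * c p) * ⟪e p, x⟫ :=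
  exists_diagOp e (C := 1) fun p => by
    rw [abs_of_pos (Real.exp_pos _), Real.exp_le_one_iff]
    nlinarith [mul_nonneg t.coe_nonneg (hc p).le]

section InvariantLaw

variable {H : Type*} [NormedAddCommGroup H] [InnerProductSpace ℝ H] [CompleteSpace H]
  [MeasurableSpace H] [BorelSpace H] [SecondCountableTopology H] {e : HilbertBasis ℕ ℝ H}
  {Ω : Type*} [MeasurableSpace Ω] {P : Measure Ω} [IsProbabilityMeasure P]

/-- A law is invariant for the SPDE if and only if it is the centered Gaussian law with the
stationary variances. -/
lemma isInvariantLaw_iff {lam q b : ℕ → ℝ} (hlam : ∀ p, 0 ≤ lam p) (hq : ∀ p, 0 ≤ q p)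
    (hc : ∀ p, 0 < lam p + b p) {σ : ℝ} (hv : Summable (spdeVar lam q b σ))
    {β : ℕ → ℝ≥0 → Ω → ℝ} (hβ : IsWienerFamily P β) {B : H →L[ℝ] H}
    (hB : ∀ p, B (e p) = -(b p • e p)) {u : H → ℝ≥0 → Ω → H}
    (hu : ∀ x, IsMildSolution P e lam q β B σ x (u x)) (μ : Measure H) :
    IsInvariantLaw P u μ ↔ HasDiagCov e (spdeVar lam q b σ) μ := by
  have hu1 : ∀ x t, IsProbabilityMeasure (P.map (u x t)) := fun x t =>
    Measure.isProbabilityMeasure_map ((hu x).1 t).aemeasurable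
  have hAR : ∀ (t : ℝ≥0) (K : Kernel H H), (∀ x, K x = P.map (u x t)) →
      IsDiagAutoRegression e (fun p => Real.exp (-t * (lam p + b p)))
        (fun p => (1 - Real.exp (-t * (lam p + b p)) ^ 2) * spdeVar lam q b σ p) K := by
    intro t K hK
    obtain ⟨S, hS⟩ := exists_semigroup_op e hc t
    refine ⟨⟨fun x => by rw [hK]; infer_instance⟩, S, hS, fun x ξ => ?_⟩
    rw [hK]
    exact (hu x).charFun_map hlam hq hc hv hβ hB t hS ξ
  constructor
  · rintro ⟨hμ1, κ, hκ, hinv⟩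
    -- Invariance at the single time 1 already determines the law.
    refine (hAR 1 (κ 1) (hκ 1)).hasDiagCov_of_invariant hv (fun p => rfl) (fun p => ?_) hμ1 (hinv 1)
    rw [abs_of_pos (Real.exp_pos _), Real.exp_lt_one_iff]
    have := hc p
    simp only [NNReal.coe_one]
    linarith
  · intro hμ
    have hker : ∀ t, ∃ K : Kernel H H, ∀ x, K x = P.map (u x t) := by
      intro t
      obtain ⟨S, hS⟩ := exists_semigroup_op e hc t
      have := hu1 0 t
      -- Measurability of `x ↦ u x t` is not given. The kernel is built from `S x + u 0 t`, which
      -- has the same law as `u x t` by comparison of characteristic functions.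
      obtain ⟨K, hK1, hK⟩ := exists_kernel_map (P.map (u 0 t)) (F := fun x y : H => S x + y)
        (by fun_prop)
      refine ⟨K, fun x => ?_⟩
      have := hu1 x t
      refine Measure.ext_of_charFun (funext fun ξ => ?_)
      rw [hK, charFun_map_const_add, (hu x).charFun_map hlam hq hc hv hβ hB t hS,
        (hu 0).charFun_map hlam hq hc hv hβ hB t hS, inner_zero_left, inner_diag_comm hS]
      simp only [Complex.ofReal_zero, zero_mul, Complex.exp_zero, one_mul]
      ring
    choose κ hκ using hker
    exact ⟨hμ.1, κ, hκ, fun t => (hAR t (κ t) (hκ t)).invariant hv (fun p => rfl) hμ⟩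

end InvariantLaw

/-! ### Noise increments and the postprocessor -/

section Increments

variable {Ω : Type*} [MeasurableSpace Ω] {P : Measure Ω} {β : ℕ → ℝ≥0 → Ω → ℝ}

lemma measurable_increment (hβ : IsWienerFamily P β) (h : ℝ) (n p : ℕ) :
    Measurable (increment β h n p) :=
  ((hβ.1 p _).sub (hβ.1 p _)).div_const _

lemma hasLaw_increment (hβ : IsWienerFamily P β) {h : ℝ} (hh : 0 < h) (n p : ℕ) :
    HasLaw (increment β h n p) (gaussianReal 0 1) P := by
  have hlaw := (hβ.2.1 p).hasLaw_sub (((n : ℝ) + 1) * h).toNNReal ((n : ℝ) * h).toNNReal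
  have h3 : nndist (((n : ℝ) + 1) * h).toNNReal.1 ((n : ℝ) * h).toNNReal.1 = h.toNNReal := by
    refine NNReal.eq ?_
    rw [coe_nndist, Real.dist_eq]
    change |((((n : ℝ) + 1) * h).toNNReal : ℝ) - (((n : ℝ) * h).toNNReal : ℝ)| = _
    rw [Real.coe_toNNReal _ (by positivity), Real.coe_toNNReal _ (by positivity),
      Real.coe_toNNReal _ hh.le, show ((n : ℝ) + 1) * h - n * h = h by ring, abs_of_pos hh]
  rw [h3] at hlaw
  have h4 := gaussianReal_div_const hlaw (√h)
  have h5 : h.toNNReal / NNReal.mk (√h ^ 2) (sq_nonneg _) = 1 := by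
    refine NNReal.eq ?_
    simp [Real.sq_sqrt hh.le, hh.le, hh.ne']
  rw [zero_div, h5] at h4
  exact h4

lemma measurePreserving_increment [IsProbabilityMeasure P] (hβ : IsWienerFamily P β) {h : ℝ}
    (hh : 0 < h) (n : ℕ) : MeasurePreserving (fun ω p => increment β h n p ω) P gaussSeq := by
  have hm : Measurable fun ω p => increment β h n p ω :=
    measurable_pi_iff.2 fun p => measurable_increment hβ h n p
  have hind : iIndepFun (fun p => increment β h n p) P :=
    hβ.2.2.comp (fun p x => (x (((n : ℝ) + 1) * h).toNNReal - x ((n : ℝ) * h).toNNReal) / √h)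
      fun p => by fun_prop
  exact ⟨hm, (hind.hasLaw_infinitePi (fun p => hasLaw_increment hβ hh n p) hm.aemeasurable).map_eq⟩

end Increments

section Postprocessor

variable {H : Type*} [NormedAddCommGroup H] [InnerProductSpace ℝ H]
  {e : HilbertBasis ℕ ℝ H} {lam q : ℕ → ℝ} {Q J₃ : H →L[ℝ] H} {h : ℝ}

lemma inner_resolvent (e : HilbertBasis ℕ ℝ H) (hl : ∀ p, 0 < lam p) {c : ℝ} (hc : 0 < c) (x : H)
    (p : ℕ) : ⟪e p, resolvent e lam c x⟫ = (1 + c * lam p)⁻¹ * ⟪e p, x⟫ :=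
  inner_spectralOp e (C := 1) (fun p => by
    have := mul_pos hc (hl p)
    rw [abs_of_pos (by positivity)]
    exact inv_le_one_of_one_le₀ (by linarith)) x p

lemma resolvent_basis (e : HilbertBasis ℕ ℝ H) (hl : ∀ p, 0 < lam p) {c : ℝ} (hc : 0 < c) (p : ℕ) :
    resolvent e lam c (e p) = (1 + c * lam p)⁻¹ • e p := by
  refine ext_inner_basis e fun k => ?_
  rw [inner_resolvent e hl hc, inner_smul_right]
  by_cases hk : k = p
  · rw [hk]
  · rw [e.orthonormal.inner_eq_zero hk, mul_zero, mul_zero]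

lemma summable_norm_resolvent (hq : ∀ p, 0 ≤ q p) (hl : ∀ p, 0 < lam p) (hh : 0 < h)
    (hs : Summable fun p => q p / lam p) :
    Summable fun p => ‖√(q p) • resolvent e lam h (e p)‖ ^ 2 := by
  refine Summable.of_nonneg_of_le (fun p => by positivity) (fun p => ?_) (hs.mul_left h⁻¹)
  have h1 := mul_pos hh (hl p)
  rw [resolvent_basis e hl hh, norm_smul, norm_smul, e.orthonormal.norm_eq_one, mul_one, mul_pow,
    Real.norm_of_nonneg (Real.sqrt_nonneg _), Real.sq_sqrt (hq p),
    Real.norm_of_nonneg (by positivity), inv_pow, ← div_eq_mul_inv, ← div_eq_inv_mul, div_div]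
  refine div_le_div_of_nonneg_left (hq p) (mul_pos (hl p) hh) ?_
  nlinarith

variable [CompleteSpace H]

/-- `J₃` need not be diagonal. The sum is the quadratic form of `J₃ Q J₃ᵀ` at `v`, and the defining
relation of `J₃` makes that form diagonal. -/
lemma hasSum_inner_postproc (hl : ∀ p, 0 < lam p) (hh : 0 < h) (hQ : ∀ p, Q (e p) = q p • e p)
    (hJ : IsPostprocOp e lam Q h J₃) (v : H) :
    HasSum (fun p => q p * ⟪J₃ (e p), v⟫ ^ 2)
      (∑' p, ((1 + h / 2 * lam p)⁻¹ * q p) * ⟪e p, v⟫ ^ 2) := by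
  have hQd : ∀ x p, ⟪e p, Q x⟫ = q p * ⟪e p, x⟫ := fun x p => by
    have := inner_of_apply_basis (B := Q) (b := fun p => -q p) (e := e)
      (fun p => by rw [hQ, neg_smul, neg_neg]) x p
    rwa [neg_neg] at this
  have h1 := e.hasSum_inner_mul_inner (ContinuousLinearMap.adjoint J₃ v)
    (Q (ContinuousLinearMap.adjoint J₃ v))
  rw [ContinuousLinearMap.adjoint_inner_left, hJ v] at h1
  have h2 := (e.hasSum_inner_mul_inner v (resolvent e lam (h / 2) (Q v))).tsum_eq
  rw [← h2] at h1
  have h3 : ∑' p, ((1 + h / 2 * lam p)⁻¹ * q p) * ⟪e p, v⟫ ^ 2 =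
      ∑' p, ⟪v, e p⟫ * ⟪e p, resolvent e lam (h / 2) (Q v)⟫ := by
    congr 1
    ext p
    rw [inner_resolvent e hl (by positivity), hQd, real_inner_comm v]
    ring
  rw [h3]
  refine h1.congr_fun fun p => ?_
  rw [hQd, ContinuousLinearMap.adjoint_inner_left, ContinuousLinearMap.adjoint_inner_right,
    real_inner_comm]
  ring

/-- This is the Hilbert–Schmidt property of `J₃ Q^{1/2}`: the double sum of squared entries, with
nonnegative terms, is finite when summed by rows, hence also by columns. -/
lemma summable_norm_postproc (hq : ∀ p, 0 ≤ q p) (hl : ∀ p, 0 < lam p) (hh : 0 < h)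
    (hs : Summable fun p => q p / lam p) (hQ : ∀ p, Q (e p) = q p • e p)
    (hJ : IsPostprocOp e lam Q h J₃) : Summable fun p => ‖√(q p) • J₃ (e p)‖ ^ 2 := by
  have hrow : ∀ k, HasSum (fun p => q p * ⟪J₃ (e p), e k⟫ ^ 2) ((1 + h / 2 * lam k)⁻¹ * q k) := by
    intro k
    have := hasSum_inner_postproc hl hh hQ hJ (e k)
    rwa [tsum_eq_single k, real_inner_self_eq_norm_sq, e.orthonormal.norm_eq_one, one_pow, one_pow,
      mul_one] at this
    intro p hp
    rw [e.orthonormal.inner_eq_zero hp]; ring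
  have hprod : Summable fun z : ℕ × ℕ => q z.2 * ⟪J₃ (e z.2), e z.1⟫ ^ 2 := by
    refine (summable_prod_of_nonneg fun z => mul_nonneg (hq _) (sq_nonneg _)).2
      ⟨fun k => (hrow k).summable, ?_⟩
    refine (summable_postprocVar hq hl hh hs).congr fun k => ?_
    exact (hrow k).tsum_eq.symm
  refine hprod.prod_symm.prod.congr fun p => ?_
  simp only [Prod.swap_prod_mk]
  rw [norm_smul, mul_pow, Real.norm_of_nonneg (Real.sqrt_nonneg _), Real.sq_sqrt (hq p),
    tsum_mul_left, ← (hasSum_inner_sq e (J₃ (e p))).tsum_eq]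
  simp_rw [real_inner_comm]

end Postprocessor

/-! ### One step of the integrator, mode by mode -/

section Step

variable {H : Type*} [NormedAddCommGroup H] [InnerProductSpace ℝ H]
  {e : HilbertBasis ℕ ℝ H} {lam q b : ℕ → ℝ} {B : H →L[ℝ] H} {σ h : ℝ}

/-- The factor `(1 - hb) / (1 + hλ)` of a mode in one step of the integrator. -/
noncomputable def stepFactor (lam b : ℕ → ℝ) (h : ℝ) (p : ℕ) : ℝ := (1 - h * b p) / (1 + h * lam p)

/-- The factor of the noise of a mode in one step of the integrator. -/
noncomputable def noiseFactor (lam b : ℕ → ℝ) (σ h : ℝ) (p : ℕ) : ℝ :=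
  (1 + h * lam p)⁻¹ * ((√2 - 1) / 2 * σ * √h - h * b p * (1 / 2 * σ * √h)) + theta * σ * √h

lemma abs_stepFactor_lt (hl : ∀ p, 0 < lam p) (hc : ∀ p, 0 < lam p + b p) (hh : 0 < h)
    (hhb : ∀ p, |h * b p| ≤ 1) (p : ℕ) : |stepFactor lam b h p| < 1 := by
  have h1 := abs_le.1 (hhb p)
  have h2 := mul_pos hh (hl p)
  have h3 := mul_pos hh (hc p)
  rw [stepFactor, abs_div, abs_of_pos (show 0 < 1 + h * lam p by linarith),
    div_lt_one (by linarith), abs_lt]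
  constructor <;> linarith

lemma inner_schemeStep (hl : ∀ p, 0 < lam p) (hh : 0 < h) (hB : ∀ p, B (e p) = -(b p • e p))
    (x η : H) (p : ℕ) : ⟪e p, schemeStep e lam B σ h x η⟫ =
      stepFactor lam b h p * ⟪e p, x⟫ + noiseFactor lam b σ h p * ⟪e p, η⟫ := by
  rw [schemeStep, inner_add_right, inner_resolvent e hl hh]
  simp only [inner_add_right, inner_smul_right, inner_of_apply_basis hB]
  rw [stepFactor, noiseFactor]
  ring

lemma exists_schemeStep_eq (hl : ∀ p, 0 < lam p) (hc : ∀ p, 0 < lam p + b p) (hh : 0 < h)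
    (hhb : ∀ p, |h * b p| ≤ 1) (hB : ∀ p, B (e p) = -(b p • e p)) (σ : ℝ) :
    ∃ S T : H →L[ℝ] H, (∀ x p, ⟪e p, S x⟫ = stepFactor lam b h p * ⟪e p, x⟫) ∧
      (∀ x p, ⟪e p, T x⟫ = noiseFactor lam b σ h p * ⟪e p, x⟫) ∧
      ∀ x η, schemeStep e lam B σ h x η = S x + T η := by
  obtain ⟨S, hS⟩ := exists_diagOp e fun p => (abs_stepFactor_lt hl hc hh hhb p).le
  have hbound : ∀ p, |noiseFactor lam b σ h p| ≤
      |(√2 - 1) / 2 * σ * √h| + |1 / 2 * σ * √h| + |theta * σ * √h| := by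
    intro p
    have h2 := mul_pos hh (hl p)
    have h3 : |(1 + h * lam p)⁻¹| ≤ 1 := by
      rw [abs_of_pos (by positivity)]
      exact inv_le_one_of_one_le₀ (by linarith)
    rw [noiseFactor]
    refine (abs_add_le _ _).trans (add_le_add_left ?_ _)
    rw [abs_mul]
    refine (mul_le_of_le_one_left (abs_nonneg _) h3).trans ((abs_sub _ _).trans ?_)
    refine add_le_add_right ?_ _
    rw [abs_mul]
    exact mul_le_of_le_one_left (abs_nonneg _) (hhb p)
  obtain ⟨T, hT⟩ := exists_diagOp e hbound
  refine ⟨S, T, hS, hT, fun x η => ext_inner_basis e fun p => ?_⟩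
  rw [inner_schemeStep hl hh hB, inner_add_right, hS, hT]

/-- This is the stationarity equation of the integrator. Because `(√2 - 1) / 2 = 1 - theta`, the
noise factor has numerator `σ √h (1 + θhλ - hb/2)`; pulling out `1 + θhλ` cancels the factor of `J₂`
and leaves the bracket of `schemeVar`. -/
lemma noise_variance_eq (hl : ∀ p, 0 < lam p) (hc : ∀ p, 0 < lam p + b p) (hh : 0 < h)
    (hhb : ∀ p, |h * b p| ≤ 1) (p : ℕ) :
    q p * ((1 + theta * h * lam p)⁻¹) ^ 2 * noiseFactor lam b σ h p ^ 2 =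
      (1 - stepFactor lam b h p ^ 2) * schemeVar lam q b σ h p := by
  have h1 := abs_le.1 (hhb p)
  have h2 := mul_pos hh (hl p)
  have h3 : (1 : ℝ) + h * lam p ≠ 0 := by linarith
  have h4 : 1 + theta * h * lam p ≠ 0 := by
    have := mul_pos theta_mem.1 h2
    nlinarith
  have h4' : 1 + theta * (h * lam p) ≠ 0 := by rwa [← mul_assoc]
  have h5 : 2 + h * lam p - h * b p ≠ 0 := by linarith
  have h6 := (hc p).ne'
  have h7 : noiseFactor lam b σ h p = σ * √h * (1 + theta * h * lam p) / (1 + h * lam p) *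
      (1 - h * b p / (2 * (1 + theta * (h * lam p)))) := by
    have hθ : (√2 - 1) / 2 = 1 - theta := by unfold theta; ring
    have hcancel : (1 + theta * h * lam p) * (1 - h * b p / (2 * (1 + theta * (h * lam p)))) =
        1 + theta * h * lam p - h * b p / 2 := by
      rw [← mul_assoc theta]
      field_simp
    rw [noiseFactor, hθ, mul_div_right_comm, mul_assoc (σ * √h / _), hcancel]
    field_simp
    ring
  have h8 : 1 - stepFactor lam b h p ^ 2 =
      h * (lam p + b p) * (2 + h * lam p - h * b p) / (1 + h * lam p) ^ 2 := by
    rw [stepFactor]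
    field_simp
    ring
  rw [h7, h8, schemeVar]
  set g := 1 - h * b p / (2 * (1 + theta * (h * lam p)))
  have h9 : √h ^ 2 = h := Real.sq_sqrt hh.le
  rw [mul_pow, div_pow, mul_pow, mul_pow, h9]
  field_simp

end Step

/-! ### The Markov chain on the product and its invariant law -/

lemma bind_comap_fst {X Y Z : Type*} [MeasurableSpace X] [MeasurableSpace Y] [MeasurableSpace Z]
    (μ : Measure (X × Y)) (κ : Kernel X Z) :
    μ.bind (κ.comap Prod.fst measurable_fst : Kernel (X × Y) Z) = μ.fst.bind κ := by
  ext s hs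
  rw [Measure.bind_apply hs (Kernel.aemeasurable _), Measure.bind_apply hs (Kernel.aemeasurable _),
    Measure.fst, lintegral_map (κ.measurable_coe hs) measurable_fst]
  rfl

lemma fst_bind {X Y Z : Type*} [MeasurableSpace X] [MeasurableSpace Y] [MeasurableSpace Z]
    (μ : Measure X) (κ : Kernel X (Y × Z)) : (μ.bind κ).fst = μ.bind κ.fst := by
  ext s hs
  rw [Measure.fst_apply hs, Measure.bind_apply (measurable_fst hs) (Kernel.aemeasurable _),
    Measure.bind_apply hs (Kernel.aemeasurable _)]
  exact lintegral_congr fun x => (Kernel.fst_apply' κ x hs).symm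

lemma snd_bind {X Y Z : Type*} [MeasurableSpace X] [MeasurableSpace Y] [MeasurableSpace Z]
    (μ : Measure X) (κ : Kernel X (Y × Z)) : (μ.bind κ).snd = μ.bind κ.snd := by
  ext s hs
  rw [Measure.snd_apply hs, Measure.bind_apply (measurable_snd hs) (Kernel.aemeasurable _),
    Measure.bind_apply hs (Kernel.aemeasurable _)]
  exact lintegral_congr fun x => (Kernel.snd_apply' κ x hs).symm

section Chain

variable {H : Type*} [NormedAddCommGroup H] [InnerProductSpace ℝ H] [CompleteSpace H]
  [MeasurableSpace H] [BorelSpace H] [SecondCountableTopology H] {e : HilbertBasis ℕ ℝ H}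
  {Ω : Type*} [MeasurableSpace Ω] {P : Measure Ω} [IsProbabilityMeasure P]

/-- The sum of the series defining `J ξ_n^Q`, as a function of the increments. -/
lemma exists_noise_map {q : ℕ → ℝ} (hq : ∀ p, 0 ≤ q p) (J : H → H)
    (hs : Summable fun p => ‖√(q p) • J (e p)‖ ^ 2)
    {β : ℕ → ℝ≥0 → Ω → ℝ} (hβ : IsWienerFamily P β) {h : ℝ} (hh : 0 < h) :
    ∃ G : (ℕ → ℝ) → H, Measurable G ∧
      (∀ ξ, charFun (gaussSeq.map G) ξ =
        (Real.exp (-(∑' p, q p * ⟪J (e p), ξ⟫ ^ 2) / 2) : ℝ)) ∧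
      (∀ n, IsNoise P e q β h n J fun ω => G fun p => increment β h n p ω) ∧
      ∀ n X, IsNoise P e q β h n J X → X =ᵐ[P] fun ω => G fun p => increment β h n p ω := by
  obtain ⟨G, hGm, hG⟩ := exists_isL2Sum_gaussSeq _ hs
  have hnoise : ∀ n, IsNoise P e q β h n J fun ω => G fun p => increment β h n p ω := by
    intro n
    have := hG.comp (fun p => ((measurable_pi_apply p).smul_const _).aestronglyMeasurable)
      (measurePreserving_increment hβ hh n)
    simp only [smul_smul] at this
    simpa only [IsNoise, mul_comm] using this
  refine ⟨G, hGm, fun ξ => ?_, hnoise, fun n X hX => ?_⟩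
  · rw [charFun_map_of_isL2Sum hs hGm hG]
    congr! 6 with p
    rw [real_inner_smul_left, mul_pow, Real.sq_sqrt (hq p)]
  · exact hX.ae_eq (fun p => (((measurable_increment hβ h n p).const_mul _).smul_const
      _).aestronglyMeasurable) (hnoise n)

variable {lam q b : ℕ → ℝ} {Q J₃ B : H →L[ℝ] H} {h : ℝ}

/-- The transition kernel of the integrator, as a function of the first component of the state. -/
lemma exists_chain_kernel (hq : ∀ p, 0 ≤ q p) (hl : ∀ p, 0 < lam p)
    (hc : ∀ p, 0 < lam p + b p) (hs : Summable fun p => q p / lam p)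
    (hQ : ∀ p, Q (e p) = q p • e p) (hB : ∀ p, B (e p) = -(b p • e p))
    {β : ℕ → ℝ≥0 → Ω → ℝ} (hβ : IsWienerFamily P β) (σ : ℝ) (hh : 0 < h)
    (hhb : ∀ p, |h * b p| ≤ 1) (hJ : IsPostprocOp e lam Q h J₃) :
    ∃ κ : Kernel H (H × H), IsMarkovKernel κ ∧
      (∀ K : Kernel (H × H) (H × H), IsChainKernel P e lam q β B σ h J₃ K ↔
        K = κ.comap (Prod.fst : H × H → H) measurable_fst) ∧
      IsDiagAutoRegression e (stepFactor lam b h)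
        (fun p => (1 - stepFactor lam b h p ^ 2) * schemeVar lam q b σ h p) κ.fst ∧
      ∀ x ξ, charFun (κ.snd x) ξ = Complex.exp ((⟪x, ξ⟫ : ℝ) * Complex.I) *
        (Real.exp (-(∑' p, σ ^ 2 * h / 4 * ((1 + h / 2 * lam p)⁻¹ * q p) * ⟪e p, ξ⟫ ^ 2) / 2) :
          ℝ) := by
  have hθh : 0 < theta * h := mul_pos theta_mem.1 hh
  obtain ⟨G₂, hG₂m, hG₂c, hG₂n, hG₂u⟩ := exists_noise_map hq (resolvent e lam (theta * h))
    (summable_norm_resolvent hq hl hθh hs) hβ hh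
  obtain ⟨G₃, hG₃m, hG₃c, hG₃n, hG₃u⟩ := exists_noise_map hq J₃
    (summable_norm_postproc hq hl hh hs hQ hJ) hβ hh
  obtain ⟨S, T, hS, hT, hST⟩ := exists_schemeStep_eq hl hc hh hhb hB σ
  have hFm : Measurable fun z : H × (ℕ → ℝ) =>
      (schemeStep e lam B σ h z.1 (G₂ z.2), postprocess σ h z.1 (G₃ z.2)) := by
    simp only [hST, postprocess]
    fun_prop
  -- The increments of every step have law `gaussSeq`, so one kernel serves all `n`.
  obtain ⟨κ, hκ1, hκ⟩ := exists_kernel_map gaussSeq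
    (F := fun x y => (schemeStep e lam B σ h x (G₂ y), postprocess σ h x (G₃ y))) hFm
  have hFx : ∀ x, Measurable fun y : ℕ → ℝ =>
      (schemeStep e lam B σ h x (G₂ y), postprocess σ h x (G₃ y)) := fun x =>
    hFm.comp measurable_prodMk_left
  have hκP : ∀ n x, κ x = P.map fun ω =>
      (schemeStep e lam B σ h x (G₂ fun p => increment β h n p ω),
        postprocess σ h x (G₃ fun p => increment β h n p ω)) := by
    intro n x
    have hmp := measurePreserving_increment hβ hh n
    rw [hκ, ← hmp.map_eq, Measure.map_map (hFx x) hmp.measurable]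
    rfl
  refine ⟨κ, hκ1, fun K => ⟨fun hK => ?_, ?_⟩, ⟨inferInstance, S, hS, fun x ξ => ?_⟩,
    fun x ξ => ?_⟩
  · obtain ⟨X₂, X₃, hX₂, hX₃, hKz⟩ := hK 0
    ext1 z
    rw [hKz, Kernel.comap_apply, hκP 0]
    refine Measure.map_congr ?_
    filter_upwards [hG₂u 0 X₂ hX₂, hG₃u 0 X₃ hX₃] with ω h2 h3
    rw [h2, h3]
  · rintro rfl n
    exact ⟨_, _, hG₂n n, hG₃n n, fun z => by rw [Kernel.comap_apply, hκP n]⟩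
  · have h1 : κ.fst x = (gaussSeq.map G₂).map fun y => S x + T y := by
      rw [Kernel.fst_apply, hκ, Measure.map_map measurable_fst (hFx x),
        Measure.map_map (by fun_prop) hG₂m]
      congr 1
      ext y
      simp [hST]
    rw [h1, charFun_apply, integral_map (by fun_prop) (by fun_prop)]
    have h3 : ∀ y, Complex.exp ((⟪S x + T y, ξ⟫ : ℝ) * Complex.I) =
        Complex.exp ((⟪x, S ξ⟫ : ℝ) * Complex.I) * Complex.exp ((⟪y, T ξ⟫ : ℝ) * Complex.I) := by
      intro y
      rw [inner_add_left, inner_diag_comm hS, inner_diag_comm hT, Complex.ofReal_add, add_mul,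
        Complex.exp_add]
    simp_rw [h3]
    rw [integral_const_mul, ← charFun_apply, hG₂c]
    congr! 7 with p
    rw [← noise_variance_eq hl hc hh hhb, resolvent_basis e hl hθh, real_inner_smul_left, hT]
    ring
  · have h1 : κ.snd x = (gaussSeq.map G₃).map fun y => x + (1 / 2 * σ * √h) • y := by
      rw [Kernel.snd_apply, hκ, Measure.map_map measurable_snd (hFx x),
        Measure.map_map (by fun_prop) hG₃m]
      rfl
    rw [h1, charFun_apply, integral_map (by fun_prop) (by fun_prop)]
    have h3 : ∀ y, Complex.exp ((⟪x + (1 / 2 * σ * √h) • y, ξ⟫ : ℝ) * Complex.I) =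
        Complex.exp ((⟪x, ξ⟫ : ℝ) * Complex.I) *
          Complex.exp ((⟪y, (1 / 2 * σ * √h) • ξ⟫ : ℝ) * Complex.I) := by
      intro y
      rw [inner_add_left, real_inner_smul_left, real_inner_smul_right, Complex.ofReal_add, add_mul,
        Complex.exp_add]
    simp_rw [h3]
    rw [integral_const_mul, ← charFun_apply, hG₃c, (hasSum_inner_postproc hl hh hQ hJ _).tsum_eq]
    congr! 7 with p
    rw [real_inner_smul_right, mul_pow, mul_pow, mul_pow, Real.sq_sqrt hh.le]
    ring

/-- The integrator has a unique invariant law, and its second marginal is the centered Gaussian law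
with variances `postVar`. -/
lemma exists_unique_chainInvariantLaw (hq : ∀ p, 0 ≤ q p) (hl : ∀ p, 0 < lam p)
    (hc : ∀ p, 0 < lam p + b p) (hs : Summable fun p => q p / lam p)
    (hQ : ∀ p, Q (e p) = q p • e p) (hB : ∀ p, B (e p) = -(b p • e p))
    {β : ℕ → ℝ≥0 → Ω → ℝ} (hβ : IsWienerFamily P β) {σ : ℝ} (hh : 0 < h)
    (hhb : ∀ p, |h * b p| ≤ 1) (hJ : IsPostprocOp e lam Q h J₃)
    (hv : Summable (schemeVar lam q b σ h)) :
    ∃ M : Measure (H × H), IsChainInvariantLaw P e lam q β B σ h J₃ M ∧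
      (∀ M' : Measure (H × H), IsChainInvariantLaw P e lam q β B σ h J₃ M' → M' = M) ∧
      HasDiagCov e (postVar lam q b σ h) M.snd := by
  obtain ⟨κ, hκ1, hκ, hAR, hsnd⟩ := exists_chain_kernel hq hl hc hs hQ hB hβ σ hh hhb hJ
  obtain ⟨μ, hμ⟩ := exists_hasDiagCov e (schemeVar_nonneg (σ := σ) hq hl hc hh hhb) hv
  have := hμ.1
  have hinv : μ.bind κ.fst = μ := hAR.invariant hv (fun p => rfl) hμ
  refine ⟨μ.bind κ, ⟨inferInstance, _, (hκ _).2 rfl, ?_⟩, ?_, ?_⟩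
  · rw [Kernel.Invariant, bind_comap_fst, fst_bind, hinv]
  · rintro M ⟨hM1, K, hK, hKM⟩
    rw [(hκ K).1 hK, Kernel.Invariant, bind_comap_fst] at hKM
    have h1 : κ.fst.Invariant M.fst := by
      rw [Kernel.Invariant, ← fst_bind, hKM]
    have h2 := hAR.hasDiagCov_of_invariant hv (fun p => rfl) (abs_stepFactor_lt hl hc hh hhb)
      inferInstance h1
    rw [← hKM, h2.unique hμ]
  · refine ⟨inferInstance, fun ξ => ?_⟩
    -- The second component is a stationary state plus an independent Gaussian term, so variances
    -- add; the correlation between the two noises of the step is irrelevant.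
    rw [snd_bind, charFun_bind]
    simp_rw [hsnd]
    have hw := (summable_postprocVar hq hl hh hs).mul_left (σ ^ 2 * h / 4)
    rw [integral_mul_const, ← charFun_apply, hμ.2, ← Complex.ofReal_mul, ← Real.exp_add]
    simp_rw [postVar, add_mul (schemeVar _ _ _ _ _ _)]
    rw [(summable_mul_inner_sq_of_summable hv e ξ).tsum_add
      (summable_mul_inner_sq_of_summable hw e ξ)]
    ring_nf

end Chain

end PostprocSPDE

/-! ### The theorem -/

theorem theorem3
    {H : Type*} [NormedAddCommGroup H] [InnerProductSpace ℝ H] [CompleteSpace H]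
    [TopologicalSpace.SeparableSpace H] [MeasurableSpace H] [BorelSpace H]
    (e : HilbertBasis ℕ ℝ H)
    -- the eigenvalues of `-A`
    (lam : ℕ → ℝ) (hlam_pos : 0 < lam 0) (hlam_mono : Monotone lam)
    (hlam_top : Tendsto lam atTop atTop)
    -- the covariance operator
    (Q : H →L[ℝ] H) (q : ℕ → ℝ) (hQ : ∀ p, Q (e p) = q p • e p) (hq : ∀ p, 0 ≤ q p)
    (hs : 0 < PostprocSPDE.sBar lam q)
    -- the linear drift perturbation; its Lipschitz constant is the operator norm `‖B‖`
    (B : H →L[ℝ] H) (b : ℕ → ℝ) (hB : ∀ p, B (e p) = -(b p • e p))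
    (hb : ∀ p, |b p| < lam 0) :
    ∃ C : ℝ → ℝ, (∀ s, 0 < C s) ∧
      ∀ (Ω : Type*) [MeasurableSpace Ω] (P : Measure Ω) [IsProbabilityMeasure P]
        (β : ℕ → ℝ≥0 → Ω → ℝ), PostprocSPDE.IsWienerFamily P β →
      ∀ (σ : ℝ) (u : H → ℝ≥0 → Ω → H),
        (∀ x, PostprocSPDE.IsMildSolution P e lam q β B σ x (u x)) →
      -- the unique invariant law of the SPDE
      ∃ μ : Measure H, PostprocSPDE.IsInvariantLaw P u μ ∧
        (∀ μ' : Measure H, PostprocSPDE.IsInvariantLaw P u μ' → μ' = μ) ∧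
      ∀ (h : ℝ) (J₃ : H →L[ℝ] H), 0 < h → h * ‖B‖ < 1 →
        PostprocSPDE.IsPostprocOp e lam Q h J₃ →
      -- the unique invariant law of the scheme, with second marginal `M.snd`
      ∃ M : Measure (H × H), PostprocSPDE.IsChainInvariantLaw P e lam q β B σ h J₃ M ∧
        (∀ M' : Measure (H × H),
          PostprocSPDE.IsChainInvariantLaw P e lam q β B σ h J₃ M' → M' = M) ∧
        -- the order of convergence
        (∀ s : ℝ, s < PostprocSPDE.sBar lam q →
          ∀ φ : H → ℝ, ContDiff ℝ 2 φ →
            BddAbove (Set.range fun v => ‖fderiv ℝ (fderiv ℝ φ) v‖) →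
            Integrable φ μ ∧ Integrable φ M.snd ∧
            |(∫ v, φ v ∂μ) - (∫ v, φ v ∂M.snd)| ≤
              C s * (⨆ v, ‖fderiv ℝ (fderiv ℝ φ) v‖) * σ ^ 2 * h ^ (1 + s)) ∧
        -- exactness of the method if `B = 0`
        (B = 0 → M.snd = μ) := by
  have : SecondCountableTopology H := UniformSpace.secondCountable_of_separable H
  have hl : ∀ p, 0 < lam p := fun p => hlam_pos.trans_le (hlam_mono (Nat.zero_le p))
  have hc : ∀ p, 0 < lam p + b p := fun p => by
    linarith [(abs_lt.1 (hb p)).1, hlam_mono (Nat.zero_le p)]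
  have hbL : ∀ p, |b p| ≤ ‖B‖ := fun p => by
    have := B.le_opNorm (e p)
    rwa [hB, norm_neg, norm_smul, e.orthonormal.norm_eq_one, mul_one, mul_one] at this
  obtain ⟨s₀, -, hs₀, -, hsum₀⟩ := PostprocSPDE.exists_exponent hs hs
  have hsum := PostprocSPDE.summable_of_exponent_le hlam_pos hlam_mono hq hs₀.le hsum₀
  obtain ⟨K, -, hK⟩ := PostprocSPDE.exists_div_add_le hlam_pos hlam_mono hlam_top hb
  -- The constant is fixed before the probability space, `σ` and `h`; the value 1 is a default for
  -- `s` outside the range of the claim.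
  have hrate : ∀ s, ∃ C, 0 < C ∧ (s < PostprocSPDE.sBar lam q → ∀ σ h : ℝ, 0 < h → h * ‖B‖ < 1 →
      ∑' p, |PostprocSPDE.spdeVar lam q b σ p - PostprocSPDE.postVar lam q b σ h p| ≤
        C * σ ^ 2 * h ^ (1 + s)) := fun s => by
    by_cases hsB : s < PostprocSPDE.sBar lam q
    · obtain ⟨C, hC, hC'⟩ :=
        PostprocSPDE.exists_variance_bound hlam_pos hlam_mono hlam_top hq hb hbL hs hsB
      exact ⟨C, hC, fun _ => hC'⟩
    · exact ⟨1, one_pos, fun h => absurd h hsB⟩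
  choose C hC hCrate using hrate
  refine ⟨C, hC, fun Ω _ P _ β hβ σ u hu => ?_⟩
  have hv0 := PostprocSPDE.spdeVar_nonneg (b := b) hq hc σ
  have hv := PostprocSPDE.summable_spdeVar hq hc hK hsum σ
  have hiff := PostprocSPDE.isInvariantLaw_iff (fun p => (hl p).le) hq hc hv hβ hB hu
  obtain ⟨μ, hμ⟩ := PostprocSPDE.exists_hasDiagCov e hv0 hv
  refine ⟨μ, (hiff μ).2 hμ, fun μ' hμ' => ((hiff μ').1 hμ').unique hμ, fun h J₃ hh hhL hJ => ?_⟩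
  have hhb : ∀ p, |h * b p| ≤ 1 := fun p => by
    rw [abs_mul, abs_of_pos hh]
    exact (mul_le_mul_of_nonneg_left (hbL p) hh.le).trans hhL.le
  have hw0 := PostprocSPDE.schemeVar_nonneg (σ := σ) hq hl hc hh hhb
  have hw : Summable (PostprocSPDE.schemeVar lam q b σ h) :=
    Summable.of_nonneg_of_le hw0 (PostprocSPDE.schemeVar_le hq hl hc hh hhb) (hv.mul_left 8)
  have hp0 : ∀ p, 0 ≤ PostprocSPDE.postVar lam q b σ h p := fun p => by
    have h1 := hl p
    have h2 := hq p
    have h3 := hw0 p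
    unfold PostprocSPDE.postVar
    positivity
  have hp : Summable (PostprocSPDE.postVar lam q b σ h) :=
    hw.add ((PostprocSPDE.summable_postprocVar hq hl hh hsum).mul_left _)
  obtain ⟨M, hM, hMu, hMsnd⟩ :=
    PostprocSPDE.exists_unique_chainInvariantLaw hq hl hc hsum hQ hB hβ hh hhb hJ hw
  refine ⟨M, hM, hMu, fun s hsB φ hφ hφb => ?_, fun hB0 => ?_⟩
  · have hbound : ∀ v, ‖fderiv ℝ (fderiv ℝ φ) v‖ ≤ ⨆ v, ‖fderiv ℝ (fderiv ℝ φ) v‖ :=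
      fun v => le_ciSup hφb v
    have := hμ.1
    have := hMsnd.1
    refine ⟨PostprocSPDE.integrable_of_bounded_hessian (hμ.integrable_norm_sq hv0 hv) hφ hbound,
      PostprocSPDE.integrable_of_bounded_hessian (hMsnd.integrable_norm_sq hp0 hp) hφ hbound, ?_⟩
    refine (PostprocSPDE.abs_integral_sub_integral_le hv0 hv hp0 hp hμ hMsnd hφ hbound).trans ?_
    refine (mul_le_mul_of_nonneg_left (hCrate s hsB σ h hh hhL)
      ((norm_nonneg (fderiv ℝ (fderiv ℝ φ) 0)).trans (hbound 0))).trans_eq ?_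
    ring
  · have hb0 : ∀ p, b p = 0 := fun p => by
      have := hbL p
      rw [hB0, norm_zero] at this
      exact abs_nonpos_iff.1 this
    have hvar : PostprocSPDE.postVar lam q b σ h = PostprocSPDE.spdeVar lam q b σ := by
      ext p
      have h1 := mul_pos hh (hl p)
      have h2 := PostprocSPDE.spdeVar_sub_postVar (q := q) (σ := σ) hl hc hh hhb p
      rw [hb0] at h2
      -- With `b = 0` the relative defect is `1 - 2/(2 + x) - x/(2 + x) = 0`.
      have h3 : 1 - 2 * (1 - h * 0 / (2 * (1 + PostprocSPDE.theta * (h * lam p)))) ^ 2 /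
          (2 + h * lam p - h * 0) - (h * lam p + h * 0) / (2 + h * lam p) = 0 := by
        simp only [mul_zero, zero_div, sub_zero, one_pow, mul_one, add_zero]
        field_simp
        ring
      rw [h3, mul_zero] at h2
      linarith
    rw [hvar] at hMsnd
    exact hMsnd.unique hμ
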